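/- Let $\mathbb H=\{(z_1,z_2)\in\mathbb C^2: |z_1|<|z_2|<1\}$ be the Hartogs triangle, $\mathbb D$ the open unit disc, $\mathbb D^*=\mathbb D\setminus\{0\}$, and let $\phi:\mathbb H\to\mathbb D\times\mathbb D^*$, $\phi(z_1,z_2)=(z_1/z_2,z_2)$. For a $(0,1)$-form $\alpha=\alpha_1\,d\bar z_1+\alpha_2\,d\bar z_2$ with locally integrable coefficients on $\mathbb H$ put $\tilde\alpha_j=\alpha_j\circ\phi^{-1}$ and let $$f=f_1\,d\bar w_1+f_2\,d\bar w_2,\qquad f_1=\bar w_2\,\tilde\alpha_1,\quad f_2=\bar w_1\,\tilde\alpha_1+\tilde\alpha_2,$$ be the corresponding form on $\mathbb D\times\mathbb D^*$. Let $\mathscr D f=\tfrac12\left(\frac{\partial f_1}{\partial\bar w_2}+\frac{\partial f_2}{\partial\bar w_1}\right)$ in the sense of distributions and, whenever $\mathscr D f$ is a locally integrable function, let $$\begin{aligned}T(f)(w)={}&\frac{-1}{2\pi i}\int_{\mathbb D^*}\frac{f_2(w_1,\zeta_2)}{\zeta_2-w_2}\,d\bar\zeta_2\wedge d\zeta_2+\frac{-1}{2\pi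 i}\int_{\mathbb D}\frac{f_1(\zeta_1,w_2)}{\zeta_1-w_1}\,d\bar\zeta_1\wedge d\zeta_1\\&+\frac{-1}{(2\pi i)^2}\int_{\mathbb D\times\mathbb D^*}\frac{\mathscr D f(\zeta_1,\zeta_2)}{(\zeta_1-w_1)(\zeta_2-w_2)}\,d\bar\zeta_1\wedge d\zeta_1\wedge d\bar\zeta_2\wedge d\zeta_2 .\end{aligned}$$ **Theorem.** Let $1\le p<\infty$. There is a constant $C>0$ such that the following holds for every $(0,1)$-form $\alpha$ on $\mathbb H$ that is $\bar\partial$-closed in the weak sense (that is, $\partial\alpha_2/\partial\bar z_1=\partial\alpha_1/\partial\bar z_2$ as distributions on $\mathbb H$), satisfies $\bar z_1\alpha_1+\bar z_2\alpha_2=0$ almost everywhere on $\mathbb H$, and has $\alpha_1\in L^p(\mathbb H)$ (with respect to Lebesgue measure, without weight). The function $T(f)$ is well defined ($\mathscr D f$ is a locally integrable function, and the integrals converge absolutely for almost every $w\in\mathbb D\times\mathbb D^*$), and $v=T(f)\circ\phi$ belongs to $L^p(\mathbb H)$, is a weak solution of $\bar\partial v=\alpha$ on $\mathbb H$, and satisfies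 $$\|v\|_{L^p(\mathbb H)}\le C\,\|\alpha_1\|_{L^p(\mathbb H)} .$$ -/

import Mathlib

open MeasureTheory
open scoped NNReal ENNReal ComplexConjugate

noncomputable section

namespace HartogsDbar

/-- The Hartogs triangle `{(z₁, z₂) : |z₁| < |z₂| < 1}` in `ℂ²`. -/
def hartogs : Set (ℂ × ℂ) := {z | ‖z.1‖ < ‖z.2‖ ∧ ‖z.2‖ < 1}

/-- The open unit disc. -/
def disc : Set ℂ := {z | ‖z‖ < 1}

/-- The punctured unit disc. -/
def puncturedDisc : Set ℂ := {z | 0 < ‖z‖ ∧ ‖z‖ < 1}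

/-- The map `φ(z₁, z₂) = (z₁ / z₂, z₂)`, a biholomorphism from the Hartogs triangle onto the
product of the disc and the punctured disc. -/
def phi (z : ℂ × ℂ) : ℂ × ℂ := (z.1 / z.2, z.2)

/-- The inverse `φ⁻¹(w₁, w₂) = (w₁ w₂, w₂)`. -/
def phiInv (w : ℂ × ℂ) : ℂ × ℂ := (w.1 * w.2, w.2)

/-- A `(0,1)`-form `c₁ dz̄₁ + c₂ dz̄₂`, given by its coefficient functions. -/
structure Form01 where
  c₁ : ℂ × ℂ → ℂ
  c₂ : ℂ × ℂ → ℂ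

/-- `∂ψ/∂z̄₁ = (∂ψ/∂x₁ + i ∂ψ/∂y₁) / 2`. -/
def dbar₁ (ψ : ℂ × ℂ → ℂ) (z : ℂ × ℂ) : ℂ :=
  (1 / 2) * (fderiv ℝ ψ z (1, 0) + Complex.I * fderiv ℝ ψ z (Complex.I, 0))

/-- `∂ψ/∂z̄₂ = (∂ψ/∂x₂ + i ∂ψ/∂y₂) / 2`. -/
def dbar₂ (ψ : ℂ × ℂ → ℂ) (z : ℂ × ℂ) : ℂ :=
  (1 / 2) * (fderiv ℝ ψ z (0, 1) + Complex.I * fderiv ℝ ψ z (0, Complex.I))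

/-- Test functions: `ψ ∈ C_c^∞(U)`. -/
def IsTest (U : Set (ℂ × ℂ)) (ψ : ℂ × ℂ → ℂ) : Prop :=
  ContDiff ℝ ((⊤ : ℕ∞) : WithTop ℕ∞) ψ ∧ HasCompactSupport ψ ∧ tsupport ψ ⊆ U

/-- The coefficients are locally integrable on `U`, so that they are distributions there. -/
def Form01.LocInt (f : Form01) (U : Set (ℂ × ℂ)) : Prop :=
  LocallyIntegrableOn f.c₁ U volume ∧ LocallyIntegrableOn f.c₂ U volume

/-- `∂̄f = 0` on `U` in the weak sense: `∂f₂/∂z̄₁ = ∂f₁/∂z̄₂` as distributions. -/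
def Form01.WeaklyClosed (f : Form01) (U : Set (ℂ × ℂ)) : Prop :=
  f.LocInt U ∧ ∀ ψ, IsTest U ψ →
    ∫ z in U, f.c₂ z * dbar₁ ψ z = ∫ z in U, f.c₁ z * dbar₂ ψ z

/-- `v` is a weak solution of `∂̄v = f` on `U`. -/
def IsWeakSolution (U : Set (ℂ × ℂ)) (v : ℂ × ℂ → ℂ) (f : Form01) : Prop :=
  LocallyIntegrableOn v U volume ∧ f.LocInt U ∧ ∀ ψ, IsTest U ψ →
    (∫ z in U, v z * dbar₁ ψ z = -∫ z in U, f.c₁ z * ψ z) ∧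
    (∫ z in U, v z * dbar₂ ψ z = -∫ z in U, f.c₂ z * ψ z)

/-- The locally integrable function `g` represents, on `U`, the distribution
`𝒟 f = (∂f₁/∂z̄₂ + ∂f₂/∂z̄₁) / 2`. -/
def IsScrD (U : Set (ℂ × ℂ)) (f : Form01) (g : ℂ × ℂ → ℂ) : Prop :=
  f.LocInt U ∧ LocallyIntegrableOn g U volume ∧ ∀ ψ, IsTest U ψ →
    ∫ z in U, g z * ψ z =
      -((1 / 2) * ((∫ z in U, f.c₁ z * dbar₂ ψ z) + ∫ z in U, f.c₂ z * dbar₁ ψ z))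

open Classical in
/-- The function `𝒟 f` on `U` (determined up to null sets in `U`), whenever the distribution
`𝒟 f` is represented by a locally integrable function. -/
def scrD (U : Set (ℂ × ℂ)) (f : Form01) : ℂ × ℂ → ℂ :=
  if h : ∃ g, IsScrD U f g then h.choose else 0

/-- `∫_D g dζ̄ ∧ dζ`; here `dζ̄ ∧ dζ = 2i dA` with `dA` the Lebesgue measure of `ℂ`. -/
def cIntegral (D : Set ℂ) (g : ℂ → ℂ) : ℂ := 2 * Complex.I * ∫ ζ in D, g ζ

/-- `∫_U g dζ̄₁ ∧ dζ₁ ∧ dζ̄₂ ∧ dζ₂`; this volume form is `(2i)² dV`. -/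
def cIntegral₂ (U : Set (ℂ × ℂ)) (g : ℂ × ℂ → ℂ) : ℂ := (2 * Complex.I) ^ 2 * ∫ ζ in U, g ζ

/-- The integral operator `T` on the product domain `D₁ × D₂`. -/
def opT (D₁ D₂ : Set ℂ) (f : Form01) (z : ℂ × ℂ) : ℂ :=
  (-1 / (2 * Real.pi * Complex.I)) * cIntegral D₂ (fun ζ₂ => f.c₂ (z.1, ζ₂) / (ζ₂ - z.2)) +
  (-1 / (2 * Real.pi * Complex.I)) * cIntegral D₁ (fun ζ₁ => f.c₁ (ζ₁, z.2) / (ζ₁ - z.1)) +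
  (-1 / (2 * Real.pi * Complex.I) ^ 2) * cIntegral₂ (D₁ ×ˢ D₂)
    (fun ζ => scrD (D₁ ×ˢ D₂) f ζ / ((ζ.1 - z.1) * (ζ.2 - z.2)))

/-- `T f` is well defined on `D₁ × D₂`: the distribution `𝒟 f` is a locally integrable function,
and the three integrals in `T f` converge absolutely at almost every point. -/
def OpTWellDefined (D₁ D₂ : Set ℂ) (f : Form01) : Prop :=
  IsScrD (D₁ ×ˢ D₂) f (scrD (D₁ ×ˢ D₂) f) ∧
  ∀ᵐ z ∂(volume.restrict (D₁ ×ˢ D₂)),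
    IntegrableOn (fun ζ₂ => f.c₂ (z.1, ζ₂) / (ζ₂ - z.2)) D₂ volume ∧
    IntegrableOn (fun ζ₁ => f.c₁ (ζ₁, z.2) / (ζ₁ - z.1)) D₁ volume ∧
    IntegrableOn (fun ζ => scrD (D₁ ×ˢ D₂) f ζ / ((ζ.1 - z.1) * (ζ.2 - z.2))) (D₁ ×ˢ D₂) volume

/-- The form `f = (φ⁻¹)^* α` on the product of the disc and the punctured disc:
`f₁ = w̄₂ α̃₁` and `f₂ = w̄₁ α̃₁ + α̃₂` with `α̃ⱼ = αⱼ ∘ φ⁻¹`. -/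
def transfer (α : Form01) : Form01 where
  c₁ := fun w => conj w.2 * α.c₁ (phiInv w)
  c₂ := fun w => conj w.1 * α.c₁ (phiInv w) + α.c₂ (phiInv w)

end HartogsDbar

end

/-!
The map `φ` identifies the Hartogs triangle with `𝔻 × 𝔻*`, and the condition
`z̄₁ α₁ + z̄₂ α₂ = 0` becomes `f₂ = 0` there. Then closedness says `∂f₁/∂w̄₂ = 0`, so `𝒟 f = 0` and
`T f` reduces to the Cauchy transform of `f₁` in the variable `w₁`. It solves `∂u/∂w̄₁ = f₁` by the
Cauchy–Pompeiu formula, and `∂u/∂w̄₂ = 0` because the transform commutes with `∂/∂w̄₂`. The Jacobian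
of `φ⁻¹` is `|w₂|²`, a weight in `w₂` only, so the transform is bounded on the weighted `L^p` by the
Schur test in `w₁`; finally `|f₁| ≤ |α₁ ∘ φ⁻¹|` as `|w₂| < 1`.
-/

namespace HartogsDbar

noncomputable section

open Set Metric Filter Topology

/-- The coefficient `b` of `z̄` in a real-linear map `L z = a z + b z̄`. The operators `∂/∂z̄` and
`∂/∂z̄ⱼ` are this coefficient of the (partial) real derivative. -/
def conjCoeff (L : ℂ →L[ℝ] ℂ) : ℂ := (1 / 2) * (L 1 + Complex.I * L Complex.I)

theorem conjCoeff_comp_mul (L : ℂ →L[ℝ] ℂ) (c : ℂ) :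
    conjCoeff (L.comp (ContinuousLinearMap.mul ℝ ℂ c)) = conj c * conjCoeff L := by
  have hL : ∀ x : ℂ, L x = x.re * L 1 + x.im * L Complex.I := fun x => by
    conv_lhs => rw [show x = x.re • (1 : ℂ) + x.im • Complex.I by simp [Complex.re_add_im]]
    rw [map_add, map_smul, map_smul, Complex.real_smul, Complex.real_smul]
  have hc : conj c = c.re - c.im * Complex.I := by simp [Complex.ext_iff]
  simp only [conjCoeff, ContinuousLinearMap.comp_apply, ContinuousLinearMap.mul_apply', mul_one]
  rw [hL c, hL (c * Complex.I), hc, Complex.mul_I_re, Complex.mul_I_im, Complex.ofReal_neg]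
  linear_combination (c.im : ℂ) / 2 * L Complex.I * Complex.I_mul_I

/-- The Cauchy–Riemann operator `∂/∂z̄` in one variable. -/
def dbar (u : ℂ → ℂ) (t : ℂ) : ℂ := conjCoeff (fderiv ℝ u t)

section CauchyPompeiu

variable {u : ℂ → ℂ}

theorem inv_mul_dbar_circleMap (u : ℂ → ℂ) {r : ℝ} (hr : r ≠ 0) (θ : ℝ) :
    r • ((circleMap 0 r θ)⁻¹ * dbar u (circleMap 0 r θ)) =
      (1 / 2) * (fderiv ℝ u (circleMap 0 r θ) (circleMap 0 1 θ) +
        Complex.I * fderiv ℝ u (circleMap 0 r θ) (circleMap 0 1 θ * Complex.I)) := by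
  have hunit : (circleMap 0 1 θ)⁻¹ = conj (circleMap 0 1 θ) :=
    Complex.inv_eq_conj (by simp)
  have hscale : (circleMap 0 r θ)⁻¹ = (r : ℂ)⁻¹ * (circleMap 0 1 θ)⁻¹ := by
    simp [circleMap, mul_comm]
  have hr' : (r : ℂ) ≠ 0 := Complex.ofReal_ne_zero.2 hr
  rw [hscale, Complex.real_smul, mul_assoc, mul_inv_cancel_left₀ hr', hunit, dbar,
    ← conjCoeff_comp_mul, conjCoeff]
  simp only [ContinuousLinearMap.comp_apply, ContinuousLinearMap.mul_apply', mul_one]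

theorem continuous_fderiv_circleMap (hu : ContDiff ℝ 1 u) (c : ℂ) :
    Continuous fun p : ℝ × ℝ => fderiv ℝ u (circleMap 0 p.1 p.2) (circleMap 0 1 p.2 * c) := by
  have hud := hu.continuous_fderiv one_ne_zero
  have hcirc : Continuous fun p : ℝ × ℝ => circleMap 0 p.1 p.2 := by unfold circleMap; fun_prop
  exact (hud.comp hcirc).clm_apply (by fun_prop)

theorem exists_eq_zero_on_circleMap {E : Type*} [Zero E] {g : ℂ → E} (hc : HasCompactSupport g) :
    ∃ R : ℝ, ∀ r θ, R ≤ r → g (circleMap 0 r θ) = 0 := by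
  obtain ⟨R, hR⟩ := hc.isCompact.isBounded.subset_ball 0
  refine ⟨R, fun r θ hr => image_eq_zero_of_notMem_tsupport fun hmem => ?_⟩
  have := hR hmem
  rw [mem_ball_zero_iff, norm_circleMap_zero] at this
  linarith [le_abs_self r]

theorem integrableOn_fderiv_circleMap (hu : ContDiff ℝ 1 u) (hc : HasCompactSupport u) (c : ℂ) :
    IntegrableOn (fun p : ℝ × ℝ => fderiv ℝ u (circleMap 0 p.1 p.2) (circleMap 0 1 p.2 * c))
      (Ioi 0 ×ˢ Ioo (-Real.pi) Real.pi) := by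
  obtain ⟨R, hR⟩ := exists_eq_zero_on_circleMap (hc.fderiv ℝ)
  have hrect := (continuous_fderiv_circleMap hu c).continuousOn.integrableOn_compact (μ := volume)
    ((isCompact_Icc (a := 0) (b := R)).prod (isCompact_Icc (a := -Real.pi) (b := Real.pi)))
  refine hrect.of_forall_sdiff_eq_zero (measurableSet_Ioi.prod measurableSet_Ioo) fun p hp => ?_
  have hp1 : R ≤ p.1 := by
    by_contra! h
    exact hp.2 ⟨⟨le_of_lt hp.1.1, h.le⟩, Ioo_subset_Icc_self hp.1.2⟩
  simp only [hR p.1 p.2 hp1, _root_.zero_apply]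

theorem integral_radial_fderiv (hu : ContDiff ℝ 1 u) (hc : HasCompactSupport u) (θ : ℝ) :
    ∫ r in Ioi (0 : ℝ), fderiv ℝ u (circleMap 0 r θ) (circleMap 0 1 θ) = -u 0 := by
  have hd : ∀ r : ℝ, HasDerivAt (fun r : ℝ => u (circleMap 0 r θ))
      (fderiv ℝ u (circleMap 0 r θ) (circleMap 0 1 θ)) r := fun r => by
    have hline : HasDerivAt (fun r : ℝ => circleMap 0 r θ) (circleMap 0 1 θ) r := by
      simpa [circleMap] using
        (Complex.ofRealCLM.hasDerivAt (x := r)).mul_const (Complex.exp (θ * Complex.I))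
    exact ((hu.differentiable one_ne_zero) _).hasFDerivAt.comp_hasDerivAt r hline
  obtain ⟨R, hR⟩ := exists_eq_zero_on_circleMap hc
  obtain ⟨R', hR'⟩ := exists_eq_zero_on_circleMap (hc.fderiv ℝ)
  have hcont : Continuous fun r : ℝ => fderiv ℝ u (circleMap 0 r θ) (circleMap 0 1 θ) := by
    simpa [Function.comp_def] using
      (continuous_fderiv_circleMap hu 1).comp (Continuous.prodMk_left θ)
  have hint : IntegrableOn (fun r : ℝ => fderiv ℝ u (circleMap 0 r θ) (circleMap 0 1 θ))
      (Ioi 0) := by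
    refine (hcont.continuousOn.integrableOn_compact (isCompact_Icc (a := 0) (b := R'))
      ).of_forall_sdiff_eq_zero measurableSet_Ioi fun r hr => ?_
    have hr' : R' ≤ r := by
      by_contra! h
      exact hr.2 ⟨le_of_lt hr.1, h.le⟩
    simp only [hR' r θ hr', _root_.zero_apply]
  have hlim : Tendsto (fun r : ℝ => u (circleMap 0 r θ)) atTop (𝓝 0) :=
    tendsto_const_nhds.congr' <| (eventually_ge_atTop R).mono fun r hr => (hR r θ hr).symm
  simpa using integral_Ioi_of_hasDerivAt_of_tendsto' (a := 0) (fun r _ => hd r) hint hlim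

theorem integral_angular_fderiv (hu : ContDiff ℝ 1 u) {r : ℝ} (hr : r ≠ 0) :
    ∫ θ in Ioo (-Real.pi) Real.pi,
      fderiv ℝ u (circleMap 0 r θ) (circleMap 0 1 θ * Complex.I) = 0 := by
  have hd : ∀ θ : ℝ, HasDerivAt (fun θ : ℝ => u (circleMap 0 r θ))
      (r * fderiv ℝ u (circleMap 0 r θ) (circleMap 0 1 θ * Complex.I)) θ := fun θ => by
    refine (((hu.differentiable one_ne_zero) _).hasFDerivAt.comp_hasDerivAt θ
      (hasDerivAt_circleMap 0 r θ)).congr_deriv ?_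
    rw [← Complex.real_smul, ← map_smul]
    simp [circleMap, mul_assoc]
  have hcont : Continuous fun θ : ℝ =>
      fderiv ℝ u (circleMap 0 r θ) (circleMap 0 1 θ * Complex.I) :=
    (continuous_fderiv_circleMap hu Complex.I).comp (Continuous.prodMk_right r)
  have hftc := intervalIntegral.integral_eq_sub_of_hasDerivAt (a := -Real.pi) (b := Real.pi)
    (fun θ _ => hd θ) ((continuous_const.mul hcont).intervalIntegrable _ _)
  have hper : circleMap 0 r Real.pi = circleMap 0 r (-Real.pi) := by
    simp [circleMap, Complex.exp_neg]
  rw [intervalIntegral.integral_const_mul, hper, sub_self] at hftc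
  rw [← integral_Ioc_eq_integral_Ioo,
    ← intervalIntegral.integral_of_le (neg_le_self Real.pi_pos.le)]
  exact (mul_eq_zero.1 hftc).resolve_left (Complex.ofReal_ne_zero.2 hr)

/-- The **Cauchy–Pompeiu formula** for compactly supported functions. -/
theorem integral_inv_mul_dbar (hu : ContDiff ℝ 1 u) (hc : HasCompactSupport u) :
    ∫ t, t⁻¹ * dbar u t = -(Real.pi * u 0) := by
  set A : Set ℝ := Ioo (-Real.pi) Real.pi
  set radial : ℝ × ℝ → ℂ := fun p => fderiv ℝ u (circleMap 0 p.1 p.2) (circleMap 0 1 p.2)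
  set angular : ℝ × ℝ → ℂ :=
    fun p => fderiv ℝ u (circleMap 0 p.1 p.2) (circleMap 0 1 p.2 * Complex.I)
  have hradial : IntegrableOn radial (Ioi 0 ×ˢ A) := by
    simpa only [mul_one] using integrableOn_fderiv_circleMap hu hc 1
  have hangular : IntegrableOn angular (Ioi 0 ×ˢ A) :=
    integrableOn_fderiv_circleMap hu hc Complex.I
  have hpolar : ∀ p ∈ polarCoord.target,
      p.1 • ((Complex.polarCoord.symm p)⁻¹ * dbar u (Complex.polarCoord.symm p)) =
        (1 / 2) * (radial p + Complex.I * angular p) := fun p hp => by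
    have hcirc : Complex.polarCoord.symm p = circleMap 0 p.1 p.2 := by
      simp [Complex.polarCoord_symm_apply, circleMap, Complex.exp_mul_I]
    rw [hcirc, inv_mul_dbar_circleMap u (ne_of_gt hp.1)]
  have hR : ∫ p in Ioi 0 ×ˢ A, radial p = -(2 * Real.pi * u 0) := by
    rw [Measure.volume_eq_prod, ← Measure.prod_restrict,
      integral_prod_symm _ (by rwa [Measure.prod_restrict])]
    simp only [radial, A, integral_radial_fderiv hu hc, integral_const,
      measureReal_restrict_apply_univ, Real.volume_real_Ioo_of_le (neg_le_self Real.pi_pos.le),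
      Complex.real_smul]
    push_cast
    ring
  have hA : ∫ p in Ioi 0 ×ˢ A, angular p = 0 := by
    rw [Measure.volume_eq_prod, setIntegral_prod _ hangular]
    exact setIntegral_eq_zero_of_forall_eq_zero fun r hr =>
      integral_angular_fderiv hu (ne_of_gt hr)
  rw [← Complex.integral_comp_polarCoord_symm,
    setIntegral_congr_fun polarCoord.open_target.measurableSet hpolar, polarCoord_target,
    integral_const_mul, integral_add hradial (hangular.const_mul _), integral_const_mul, hR, hA]
  ring

end CauchyPompeiu

section Dbar

variable {E : Type*} [NormedAddCommGroup E] [NormedSpace ℝ E]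

/-- The antiholomorphic derivative of `ψ` along a real-linear embedding `ι` of `ℂ`. The operators
`∂/∂z̄₁` and `∂/∂z̄₂` on `ℂ²` are the cases of the two coordinate embeddings. -/
def dbarAlong (ι : ℂ →L[ℝ] E) (ψ : E → ℂ) (z : E) : ℂ := conjCoeff ((fderiv ℝ ψ z).comp ι)

theorem dbar₁_eq_dbarAlong (ψ : ℂ × ℂ → ℂ) :
    dbar₁ ψ = dbarAlong (ContinuousLinearMap.inl ℝ ℂ ℂ) ψ := rfl

theorem dbar₂_eq_dbarAlong (ψ : ℂ × ℂ → ℂ) :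
    dbar₂ ψ = dbarAlong (ContinuousLinearMap.inr ℝ ℂ ℂ) ψ := rfl

variable (ι : ℂ →L[ℝ] E) {f g ψ : E → ℂ}

theorem dbarAlong_mul {z : E} (hf : DifferentiableAt ℝ f z) (hg : DifferentiableAt ℝ g z) :
    dbarAlong ι (fun w => f w * g w) z = f z * dbarAlong ι g z + dbarAlong ι f z * g z := by
  simp only [dbarAlong, conjCoeff, fderiv_fun_mul hf hg, ContinuousLinearMap.comp_apply,
    _root_.add_apply, _root_.smul_apply, smul_eq_mul]
  ring

theorem dbarAlong_eq_zero_of_notMem_tsupport {z : E} (hz : z ∉ tsupport ψ) :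
    dbarAlong ι ψ z = 0 := by
  have hfderiv : fderiv ℝ ψ z = 0 :=
    image_eq_zero_of_notMem_tsupport fun h => hz (tsupport_fderiv_subset ℝ h)
  simp [dbarAlong, conjCoeff, hfderiv]

theorem tsupport_dbarAlong_subset : tsupport (dbarAlong ι ψ) ⊆ tsupport ψ :=
  closure_minimal (fun _ hz => not_imp_comm.1 (dbarAlong_eq_zero_of_notMem_tsupport ι) hz)
    (isClosed_tsupport ψ)

theorem IsTest.dbarAlong {U : Set (ℂ × ℂ)} {χ : ℂ × ℂ → ℂ} (hχ : IsTest U χ)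
    (ι : ℂ →L[ℝ] ℂ × ℂ) : IsTest U (dbarAlong ι χ) := by
  obtain ⟨hsmooth, hcompact, hsub⟩ := hχ
  refine ⟨?_, hcompact.mono' (subset_tsupport _ |>.trans (tsupport_dbarAlong_subset ι)),
    (tsupport_dbarAlong_subset ι).trans hsub⟩
  have := hsmooth.fderiv_right (m := ((⊤ : ℕ∞) : WithTop ℕ∞)) le_rfl
  unfold HartogsDbar.dbarAlong conjCoeff
  fun_prop

end Dbar

section CauchyKernel

/-- The fundamental solution `1 / (π t)` of `∂/∂t̄`. -/
def cauchyKernel (t : ℂ) : ℂ := (Real.pi * t)⁻¹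

theorem cauchyKernel_neg (t : ℂ) : cauchyKernel (-t) = -cauchyKernel t := by
  simp [cauchyKernel]

theorem measurable_cauchyKernel : Measurable cauchyKernel := by
  unfold cauchyKernel
  fun_prop

theorem locallyIntegrable_cauchyKernel : LocallyIntegrable cauchyKernel := by
  refine locallyIntegrable_of_norm_le_rpow (C := Real.pi⁻¹) (α := 1) (by simp) (by simp)
    (Eventually.of_forall fun t => ?_) measurable_cauchyKernel.aestronglyMeasurable
  simp [cauchyKernel, Real.rpow_neg_one, abs_of_pos Real.pi_pos, mul_comm]

theorem integral_cauchyKernel_mul_dbar {u : ℂ → ℂ} (hu : ContDiff ℝ 1 u)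
    (hc : HasCompactSupport u) (w : ℂ) : ∫ ζ, cauchyKernel (w - ζ) * dbar u ζ = u w := by
  have hpi : (Real.pi : ℂ) ≠ 0 := Complex.ofReal_ne_zero.2 Real.pi_ne_zero
  have hcp := integral_inv_mul_dbar (u := fun t => u (w + t)) (hu.comp (by fun_prop))
    (hc.comp_homeomorph (Homeomorph.addLeft w))
  have hker : ∀ t, cauchyKernel (w - (w + t)) * dbar u (w + t) =
      -(Real.pi : ℂ)⁻¹ * (t⁻¹ * dbar (fun t => u (w + t)) t) := fun t => by
    simp only [dbar, fderiv_comp_add_left, sub_add_cancel_left, cauchyKernel, mul_inv]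
    ring
  rw [← integral_add_left_eq_self _ w]
  simp only [hker, integral_const_mul, hcp, add_zero]
  field_simp

end CauchyKernel

section TransformOfTest

variable {χ : ℂ × ℂ → ℂ}

/-- The Cauchy transform of `F` in the first variable, with respect to the measure `μ`. -/
def cauchyTransform (μ : Measure ℂ) (F : ℂ × ℂ → ℂ) (w : ℂ × ℂ) : ℂ :=
  ∫ ζ, cauchyKernel (w.1 - ζ) * F (ζ, w.2) ∂μ

theorem cauchyTransform_volume_eq (χ : ℂ × ℂ → ℂ) (z : ℂ × ℂ) :
    cauchyTransform volume χ z = ∫ t, cauchyKernel t * χ (z.1 - t, z.2) := by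
  rw [cauchyTransform, ← integral_sub_left_eq_self _ _ z.1]
  simp only [sub_sub_cancel]

theorem hasCompactSupport_slice {E : Type*} [Zero E] {g : ℂ × ℂ → E} (hg : HasCompactSupport g)
    (z : ℂ × ℂ) : HasCompactSupport fun t => g (z.1 - t, z.2) := by
  have hiso : Isometry fun t : ℂ => (z.1 - t, z.2) :=
    Isometry.of_dist_eq fun s t => by
      rw [Prod.dist_eq, dist_sub_left, dist_self, max_eq_left dist_nonneg]
  exact hg.comp_isClosedEmbedding hiso.isClosedEmbedding

theorem integrable_cauchyKernel_smul_slice {E : Type*} [NormedAddCommGroup E] [NormedSpace ℂ E]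
    {g : ℂ × ℂ → E} (hg : Continuous g) (hc : HasCompactSupport g) (z : ℂ × ℂ) :
    Integrable fun t => cauchyKernel t • g (z.1 - t, z.2) :=
  locallyIntegrable_cauchyKernel.integrable_smul_right_of_hasCompactSupport
    (hg.comp (by fun_prop)) (hasCompactSupport_slice hc z)

open scoped Convolution in
theorem contDiff_cauchyTransform {n : ℕ∞} (hχ : ContDiff ℝ n χ) (hc : HasCompactSupport χ) :
    ContDiff ℝ n (cauchyTransform volume χ) := by
  have hconv : cauchyTransform volume χ = (fun q : ℂ × ℂ =>
      (cauchyKernel ⋆[ContinuousLinearMap.mul ℝ ℂ, volume] fun x => χ (x, q.1)) q.2) ∘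
        Prod.swap := by
    ext z
    simp [cauchyTransform_volume_eq, convolution_def]
  rw [hconv]
  refine ContDiff.comp ?_ (contDiff_snd.prodMk contDiff_fst)
  rw [← contDiffOn_univ, ← univ_prod_univ]
  exact contDiffOn_convolution_right_with_param (g := fun p x => χ (x, p)) _ isOpen_univ
    (hc.isCompact.image continuous_fst)
    (fun p x _ hx => image_eq_zero_of_notMem_tsupport fun h => hx ⟨_, h, rfl⟩)
    locallyIntegrable_cauchyKernel (hχ.comp (contDiff_snd.prodMk contDiff_fst)).contDiffOn

theorem exists_integrable_bound_cauchyKernel_smul_slice {E : Type*} [NormedAddCommGroup E]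
    [NormedSpace ℂ E] {g : ℂ × ℂ → E} (hg : Continuous g) (hc : HasCompactSupport g)
    (z : ℂ × ℂ) : ∃ bound : ℂ → ℝ, Integrable bound ∧
      ∀ t, ∀ w ∈ ball z 1, ‖cauchyKernel t • g (w.1 - t, w.2)‖ ≤ bound t := by
  obtain ⟨r, hr⟩ := hc.isCompact.isBounded.subset_ball 0
  obtain ⟨M, hM⟩ := hc.exists_bound_of_continuous hg
  set B : Set ℂ := closedBall 0 (r + ‖z.1‖ + 1)
  refine ⟨B.indicator fun t => ‖cauchyKernel t‖ * M,
    (integrable_indicator_iff measurableSet_closedBall).2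
      ((locallyIntegrable_cauchyKernel.integrableOn_isCompact
        (isCompact_closedBall _ _)).norm.mul_const M), fun t w hw => ?_⟩
  by_cases ht : t ∈ B
  · rw [indicator_of_mem ht, norm_smul]
    gcongr
    exact hM _
  · suffices hg0 : g (w.1 - t, w.2) = 0 by rw [indicator_of_notMem ht, hg0, smul_zero, norm_zero]
    refine image_eq_zero_of_notMem_tsupport fun hmem => ht (mem_closedBall_zero_iff.2 ?_)
    have hslice : ‖w.1 - t‖ < r := (norm_fst_le _).trans_lt (mem_ball_zero_iff.1 (hr hmem))
    have hnear : ‖w.1 - z.1‖ < 1 := (norm_fst_le (w - z)).trans_lt (mem_ball_iff_norm.1 hw)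
    have htri : ‖t‖ ≤ ‖z.1‖ + ‖w.1 - z.1‖ + ‖w.1 - t‖ := by
      calc ‖t‖ = ‖z.1 + (w.1 - z.1) - (w.1 - t)‖ := by congr 1; ring
        _ ≤ _ := (norm_sub_le _ _).trans (by gcongr; exact norm_add_le _ _)
    linarith

theorem hasFDerivAt_cauchyTransform (hχ : ContDiff ℝ 1 χ) (hc : HasCompactSupport χ)
    (z : ℂ × ℂ) : HasFDerivAt (cauchyTransform volume χ)
      (∫ t, cauchyKernel t • fderiv ℝ χ (z.1 - t, z.2)) z := by
  have hχ' := hχ.continuous_fderiv one_ne_zero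
  have hint := fun w => integrable_cauchyKernel_smul_slice hχ.continuous hc w
  have hint' := integrable_cauchyKernel_smul_slice hχ' (hc.fderiv ℝ) z
  obtain ⟨bound, hbound, hle⟩ :=
    exists_integrable_bound_cauchyKernel_smul_slice hχ' (hc.fderiv ℝ) z
  have hderiv : ∀ (t : ℂ) (w : ℂ × ℂ), HasFDerivAt (fun w => cauchyKernel t • χ (w.1 - t, w.2))
      (cauchyKernel t • fderiv ℝ χ (w.1 - t, w.2)) w := fun t w => by
    have hshift : HasFDerivAt (fun w : ℂ × ℂ => (w.1 - t, w.2)) (.id ℝ (ℂ × ℂ)) w :=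
      ((hasFDerivAt_fst.sub_const t).prodMk hasFDerivAt_snd).congr_fderiv (by ext <;> simp)
    exact ((hχ.differentiable one_ne_zero _).hasFDerivAt.comp w hshift).const_smul (cauchyKernel t)
  rw [funext (cauchyTransform_volume_eq χ)]
  exact hasFDerivAt_integral_of_dominated_of_fderiv_le (𝕜 := ℝ) (ball_mem_nhds z one_pos)
    (Eventually.of_forall fun w => (hint w).aestronglyMeasurable) (hint z)
    hint'.aestronglyMeasurable (Eventually.of_forall hle) hbound
    (Eventually.of_forall fun t w _ => hderiv t w)

theorem dbarAlong_cauchyTransform (hχ : ContDiff ℝ 1 χ) (hc : HasCompactSupport χ)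
    (ι : ℂ →L[ℝ] ℂ × ℂ) :
    dbarAlong ι (cauchyTransform volume χ) = cauchyTransform volume (dbarAlong ι χ) := by
  ext z
  have hint := integrable_cauchyKernel_smul_slice (hχ.continuous_fderiv one_ne_zero)
    (hc.fderiv ℝ) z
  simp only [dbarAlong, conjCoeff, cauchyTransform_volume_eq, ContinuousLinearMap.comp_apply,
    (hasFDerivAt_cauchyTransform hχ hc z).fderiv, ContinuousLinearMap.integral_apply hint]
  rw [← integral_const_mul, ← integral_add (hint.apply_continuousLinearMap _)
    ((hint.apply_continuousLinearMap _).const_mul _), ← integral_const_mul]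
  refine integral_congr_ae (Eventually.of_forall fun t => ?_)
  simp only [_root_.smul_apply, smul_eq_mul]
  ring

theorem cauchyTransform_dbar₁ (hχ : ContDiff ℝ 1 χ) (hc : HasCompactSupport χ) :
    cauchyTransform volume (dbar₁ χ) = χ := by
  ext z
  have hslice : ∀ ζ, dbar₁ χ (ζ, z.2) = dbar (fun t => χ (t, z.2)) ζ := fun ζ => by
    have h := (hχ.differentiable one_ne_zero (ζ, z.2)).hasFDerivAt.comp ζ
      (hasFDerivAt_prodMk_left (𝕜 := ℝ) ζ z.2)
    rw [dbar, show fderiv ℝ (fun t => χ (t, z.2)) ζ = _ from h.fderiv]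
    rfl
  have hiso : Isometry fun t : ℂ => (t, z.2) :=
    Isometry.of_dist_eq fun s t => by simp [Prod.dist_eq]
  simp only [cauchyTransform, hslice]
  exact integral_cauchyKernel_mul_dbar (u := fun t => χ (t, z.2)) (hχ.comp (by fun_prop))
    (hc.comp_isClosedEmbedding hiso.isClosedEmbedding) z.1

end TransformOfTest

section Schur

variable {X Y : Type*} [MeasurableSpace X] [MeasurableSpace Y]

theorem rpow_lintegral_mul_le {ν : Measure Y} {k g : Y → ℝ≥0∞} (hk : AEMeasurable k ν)
    (hg : AEMeasurable g ν) {q : ℝ} (hq : 1 ≤ q) :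
    (∫⁻ y, k y * g y ∂ν) ^ q ≤ (∫⁻ y, k y * g y ^ q ∂ν) * (∫⁻ y, k y ∂ν) ^ (q - 1) := by
  have hq0 : 0 < q := one_pos.trans_le hq
  set κ := ν.withDensity k
  have hκ : ∀ {h : Y → ℝ≥0∞}, AEMeasurable h ν → ∫⁻ y, h y ∂κ = ∫⁻ y, k y * h y ∂ν := fun hh =>
    lintegral_withDensity_eq_lintegral_mul₀ hk hh
  have hmass : κ univ = ∫⁻ y, k y ∂ν := by rw [withDensity_apply _ .univ, setLIntegral_univ]
  have hjensen := eLpNorm'_le_eLpNorm'_mul_rpow_measure_univ one_pos hq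
    (hg.mono' (withDensity_absolutelyContinuous ν k)).aestronglyMeasurable
  simp only [eLpNorm', enorm_eq_self, ENNReal.rpow_one, div_one] at hjensen
  rw [← hκ hg, ← hκ (hg.pow_const q), ← hmass]
  calc (∫⁻ y, g y ∂κ) ^ q
      ≤ ((∫⁻ y, g y ^ q ∂κ) ^ (1 / q) * κ univ ^ (1 - 1 / q)) ^ q := by gcongr
    _ = (∫⁻ y, g y ^ q ∂κ) * κ univ ^ (q - 1) := by
      rw [ENNReal.mul_rpow_of_nonneg _ _ hq0.le, ← ENNReal.rpow_mul, ← ENNReal.rpow_mul,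
        one_div_mul_cancel hq0.ne', ENNReal.rpow_one, sub_mul, one_div_mul_cancel hq0.ne', one_mul]

/-- The **Schur test**. -/
theorem lintegral_rpow_lintegral_mul_le {μ : Measure X} {ν : Measure Y} [SFinite μ] [SFinite ν]
    {k : X → Y → ℝ≥0∞} (hk : Measurable (Function.uncurry k)) {g : Y → ℝ≥0∞}
    (hg : AEMeasurable g ν) {C : ℝ≥0} (hrow : ∀ x, ∫⁻ y, k x y ∂ν ≤ C)
    (hcol : ∀ y, ∫⁻ x, k x y ∂μ ≤ C) {q : ℝ} (hq : 1 ≤ q) :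
    ∫⁻ x, (∫⁻ y, k x y * g y ∂ν) ^ q ∂μ ≤ C ^ q * ∫⁻ y, g y ^ q ∂ν := by
  have hq' : 0 ≤ q - 1 := sub_nonneg.2 hq
  have hpow : (C : ℝ≥0∞) ^ (q - 1) ≠ ∞ := ENNReal.rpow_ne_top_of_nonneg hq' ENNReal.coe_ne_top
  have hmeas : AEMeasurable (Function.uncurry fun x y => k x y * g y ^ q) (μ.prod ν) :=
    hk.aemeasurable.mul (hg.pow_const q).comp_snd
  calc ∫⁻ x, (∫⁻ y, k x y * g y ∂ν) ^ q ∂μ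
      ≤ ∫⁻ x, (∫⁻ y, k x y * g y ^ q ∂ν) * C ^ (q - 1) ∂μ := by
        refine lintegral_mono fun x => (rpow_lintegral_mul_le (k := k x)
          hk.of_uncurry_left.aemeasurable hg hq).trans ?_
        gcongr
        exact hrow x
    _ = (∫⁻ y, (∫⁻ x, k x y ∂μ) * g y ^ q ∂ν) * C ^ (q - 1) := by
        rw [lintegral_mul_const' _ _ hpow, lintegral_lintegral_swap hmeas]
        have hcolumn : ∀ y, Measurable fun x => k x y := fun y => hk.of_uncurry_right
        simp only [lintegral_mul_const _ (hcolumn _)]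
    _ ≤ (∫⁻ y, C * g y ^ q ∂ν) * C ^ (q - 1) := by
        gcongr with y
        exact hcol y
    _ = C ^ q * ∫⁻ y, g y ^ q ∂ν := by
        rw [lintegral_const_mul' _ _ ENNReal.coe_ne_top, mul_right_comm]
        nth_rw 1 [← ENNReal.rpow_one (C : ℝ≥0∞)]
        rw [← ENNReal.rpow_add_of_nonneg _ _ zero_le_one hq', add_sub_cancel]

end Schur

section CauchyTransform

theorem exists_lintegral_cauchyKernel_sub_le {S : Set ℂ} (hS : volume S ≠ ∞) :
    ∃ C : ℝ≥0, ∀ x, ∫⁻ ζ in S, ‖cauchyKernel (x - ζ)‖ₑ ≤ C := by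
  set near : ℂ → ℝ≥0∞ := (ball (0 : ℂ) 1).indicator fun t => ‖cauchyKernel t‖ₑ
  have hnear_fin : ∫⁻ t, near t ≠ ∞ := by
    rw [lintegral_indicator measurableSet_ball]
    exact ((locallyIntegrable_cauchyKernel.integrableOn_isCompact (isCompact_closedBall 0 1)
      ).mono_set ball_subset_closedBall).hasFiniteIntegral.ne
  have hbound : ∀ t, ‖cauchyKernel t‖ₑ ≤ near t + 1 := fun t => by
    by_cases ht : t ∈ ball (0 : ℂ) 1
    · simp [near, indicator_of_mem ht]
    · have h1 : 1 ≤ ‖t‖ := by simpa using ht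
      have hle : ‖cauchyKernel t‖ ≤ 1 := by
        simp only [cauchyKernel, norm_inv, norm_mul, Complex.norm_real, Real.norm_eq_abs,
          abs_of_pos Real.pi_pos]
        exact inv_le_one_of_one_le₀ (one_le_mul_of_one_le_of_one_le
          (one_le_two.trans Real.two_le_pi) h1)
      simp only [near, indicator_of_notMem ht, zero_add, ← ofReal_norm]
      exact ENNReal.ofReal_le_one.2 hle
  refine ⟨((∫⁻ t, near t) + volume S).toNNReal, fun x => ?_⟩
  rw [ENNReal.coe_toNNReal (ENNReal.add_ne_top.2 ⟨hnear_fin, hS⟩)]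
  calc ∫⁻ ζ in S, ‖cauchyKernel (x - ζ)‖ₑ
      ≤ ∫⁻ ζ in S, (near (x - ζ) + 1) := lintegral_mono fun ζ => hbound (x - ζ)
    _ = (∫⁻ ζ in S, near (x - ζ)) + volume S := by
        rw [lintegral_add_right _ measurable_const, setLIntegral_one]
    _ ≤ (∫⁻ ζ, near (x - ζ)) + volume S := by
        gcongr
        exact Measure.restrict_le_self
    _ = (∫⁻ t, near t) + volume S := by rw [lintegral_sub_left_eq_self]

theorem measurePreserving_exchange_fst (μ ν : Measure ℂ) [SFinite μ] [SFinite ν] :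
    MeasurePreserving (fun q : (ℂ × ℂ) × ℂ => ((q.2, q.1.2), q.1.1))
      ((μ.prod ν).prod μ) ((μ.prod ν).prod μ) :=
  Measure.measurePreserving_swap.comp
    (((MeasurePreserving.id μ).prod Measure.measurePreserving_swap).comp
      (measurePreserving_prodAssoc μ ν μ))

variable {μ ν : Measure ℂ} [SFinite μ] [SFinite ν] {C : ℝ≥0} {F : ℂ × ℂ → ℂ}

theorem aestronglyMeasurable_cauchyKernel_mul (hF : AEStronglyMeasurable F (μ.prod ν)) :
    AEStronglyMeasurable (fun q : (ℂ × ℂ) × ℂ => cauchyKernel (q.1.1 - q.2) * F (q.2, q.1.2))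
      ((μ.prod ν).prod μ) :=
  AEStronglyMeasurable.mul
    (measurable_cauchyKernel.comp (by fun_prop)).aestronglyMeasurable
    (hF.comp_fst.comp_measurePreserving (measurePreserving_exchange_fst μ ν))

theorem aestronglyMeasurable_cauchyTransform (hF : AEStronglyMeasurable F (μ.prod ν)) :
    AEStronglyMeasurable (cauchyTransform μ F) (μ.prod ν) :=
  (aestronglyMeasurable_cauchyKernel_mul hF).integral_prod_right'

variable (hμ : ∀ x, ∫⁻ ζ, ‖cauchyKernel (x - ζ)‖ₑ ∂μ ≤ C)
include hμ

theorem eLpNorm_top_cauchyTransform_le (F : ℂ × ℂ → ℂ) :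
    eLpNorm (cauchyTransform μ F) ∞ (μ.prod ν) ≤ C * eLpNorm F ∞ (μ.prod ν) := by
  set M := eLpNormEssSup F (μ.prod ν)
  have hF : ∀ᵐ c ∂ν, ∀ᵐ ζ ∂μ, ‖F (ζ, c)‖ₑ ≤ M :=
    Measure.ae_ae_of_ae_prod (Measure.measurePreserving_swap.quasiMeasurePreserving.ae
      (enorm_ae_le_eLpNormEssSup F (μ.prod ν)))
  rw [eLpNorm_exponent_top, eLpNorm_exponent_top]
  refine eLpNormEssSup_le_of_ae_enorm_bound ?_
  filter_upwards [Measure.quasiMeasurePreserving_snd.ae hF] with w hw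
  calc ‖cauchyTransform μ F w‖ₑ
      ≤ ∫⁻ ζ, ‖cauchyKernel (w.1 - ζ) * F (ζ, w.2)‖ₑ ∂μ := enorm_integral_le_lintegral_enorm _
    _ ≤ ∫⁻ ζ, ‖cauchyKernel (w.1 - ζ)‖ₑ * M ∂μ :=
        lintegral_mono_ae (hw.mono fun ζ hζ => by rw [enorm_mul]; gcongr)
    _ = (∫⁻ ζ, ‖cauchyKernel (w.1 - ζ)‖ₑ ∂μ) * M :=
        lintegral_mul_const'' _ (measurable_cauchyKernel.comp (by fun_prop)).enorm.aemeasurable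
    _ ≤ C * M := by gcongr; exact hμ w.1

theorem lintegral_rpow_cauchyTransform_le (hF : AEStronglyMeasurable F (μ.prod ν)) {q : ℝ}
    (hq : 1 ≤ q) : ∫⁻ w, ‖cauchyTransform μ F w‖ₑ ^ q ∂(μ.prod ν) ≤
      C ^ q * ∫⁻ w, ‖F w‖ₑ ^ q ∂(μ.prod ν) := by
  have hker : Measurable (Function.uncurry fun x ζ : ℂ => ‖cauchyKernel (x - ζ)‖ₑ) :=
    (measurable_cauchyKernel.comp (by fun_prop : Measurable fun p : ℂ × ℂ => p.1 - p.2)).enorm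
  have hμ' : ∀ ζ, ∫⁻ x, ‖cauchyKernel (x - ζ)‖ₑ ∂μ ≤ C := fun ζ => by
    simpa only [← neg_sub ζ, cauchyKernel_neg, enorm_neg] using hμ ζ
  rw [lintegral_prod_symm _ ((aestronglyMeasurable_cauchyTransform hF).enorm.pow_const q),
    lintegral_prod_symm _ (hF.enorm.pow_const q),
    ← lintegral_const_mul' _ _ (ENNReal.rpow_ne_top_of_nonneg (by linarith) ENNReal.coe_ne_top)]
  refine lintegral_mono_ae (hF.prodMk_right.mono fun c hc => ?_)
  calc ∫⁻ x, ‖cauchyTransform μ F (x, c)‖ₑ ^ q ∂μ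
      ≤ ∫⁻ x, (∫⁻ ζ, ‖cauchyKernel (x - ζ)‖ₑ * ‖F (ζ, c)‖ₑ ∂μ) ^ q ∂μ := by
        gcongr with x
        simpa only [cauchyTransform, enorm_mul] using enorm_integral_le_lintegral_enorm (μ := μ)
          fun ζ => cauchyKernel (x - ζ) * F (ζ, c)
    _ ≤ C ^ q * ∫⁻ ζ, ‖F (ζ, c)‖ₑ ^ q ∂μ :=
        lintegral_rpow_lintegral_mul_le hker hc.enorm hμ hμ' hq

theorem eLpNorm_cauchyTransform_le (hF : AEStronglyMeasurable F (μ.prod ν)) {p : ℝ≥0∞}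
    (hp : 1 ≤ p) : eLpNorm (cauchyTransform μ F) p (μ.prod ν) ≤ C * eLpNorm F p (μ.prod ν) := by
  rcases eq_or_ne p ∞ with rfl | hp'
  · exact eLpNorm_top_cauchyTransform_le hμ F
  have hp0 : p ≠ 0 := (one_pos.trans_le hp).ne'
  have hq : 1 ≤ p.toReal := by simpa using ENNReal.toReal_mono hp' hp
  have hq0 : 0 < p.toReal := one_pos.trans_le hq
  rw [eLpNorm_eq_lintegral_rpow_enorm_toReal hp0 hp',
    eLpNorm_eq_lintegral_rpow_enorm_toReal hp0 hp']
  refine (ENNReal.rpow_le_rpow (lintegral_rpow_cauchyTransform_le hμ hF hq)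
    (one_div_nonneg.2 hq0.le)).trans_eq ?_
  rw [ENNReal.mul_rpow_of_nonneg _ _ (one_div_nonneg.2 hq0.le), ← ENNReal.rpow_mul,
    mul_one_div_cancel hq0.ne', ENNReal.rpow_one]

theorem integrable_mul_cauchyKernel {ρ : Measure (ℂ × ℂ)} (hF : Integrable F ρ) :
    Integrable (fun q : (ℂ × ℂ) × ℂ => F q.1 * cauchyKernel (q.1.1 - q.2)) (ρ.prod μ) := by
  have hmeas : AEStronglyMeasurable (fun q : (ℂ × ℂ) × ℂ => F q.1 * cauchyKernel (q.1.1 - q.2))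
      (ρ.prod μ) :=
    hF.aestronglyMeasurable.comp_fst.mul
      (measurable_cauchyKernel.comp (by fun_prop)).aestronglyMeasurable
  refine ⟨hmeas, ?_⟩
  calc ∫⁻ q, ‖F q.1 * cauchyKernel (q.1.1 - q.2)‖ₑ ∂(ρ.prod μ)
      = ∫⁻ w, ‖F w‖ₑ * ∫⁻ ζ, ‖cauchyKernel (w.1 - ζ)‖ₑ ∂μ ∂ρ := by
        rw [lintegral_prod _ hmeas.enorm]
        simp only [enorm_mul, lintegral_const_mul' _ _ enorm_ne_top]
    _ ≤ ∫⁻ w, ‖F w‖ₑ * C ∂ρ := by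
        gcongr with w
        exact hμ w.1
    _ < ∞ := by
        rw [lintegral_mul_const' _ _ ENNReal.coe_ne_top]
        exact ENNReal.mul_lt_top hF.hasFiniteIntegral ENNReal.coe_lt_top

theorem integrable_mul_cauchyKernel_mul (hF : Integrable F (μ.prod ν)) {χ : ℂ × ℂ → ℂ}
    (hχ : AEStronglyMeasurable χ (μ.prod ν)) {B : ℝ} (hB : ∀ w, ‖χ w‖ ≤ B) :
    Integrable (fun q : (ℂ × ℂ) × ℂ => F q.1 * (cauchyKernel (q.1.1 - q.2) * χ (q.2, q.1.2)))
      ((μ.prod ν).prod μ) := by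
  simp only [← mul_assoc]
  exact (integrable_mul_cauchyKernel hμ hF).mul_bdd (c := B) (hχ.comp_fst.comp_measurePreserving
    (measurePreserving_exchange_fst μ ν)) (Eventually.of_forall fun q => hB _)

theorem integrable_cauchyKernel_mul_mul (hF : Integrable F (μ.prod ν)) {χ : ℂ × ℂ → ℂ}
    (hχ : AEStronglyMeasurable χ (μ.prod ν)) {B : ℝ} (hB : ∀ w, ‖χ w‖ ≤ B) :
    Integrable (fun q : (ℂ × ℂ) × ℂ => cauchyKernel (q.1.1 - q.2) * F (q.2, q.1.2) * χ q.1)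
      ((μ.prod ν).prod μ) := by
  refine (((measurePreserving_exchange_fst μ ν).integrable_comp_of_integrable
    (integrable_mul_cauchyKernel_mul hμ hF hχ hB)).neg).congr (Eventually.of_forall fun q => ?_)
  simp only [Pi.neg_apply, Function.comp_apply, ← neg_sub q.1.1, cauchyKernel_neg]
  ring

theorem integrable_cauchyTransform_mul (hF : Integrable F (μ.prod ν)) {χ : ℂ × ℂ → ℂ}
    (hχ : AEStronglyMeasurable χ (μ.prod ν)) {B : ℝ} (hB : ∀ w, ‖χ w‖ ≤ B) :
    Integrable (fun w => cauchyTransform μ F w * χ w) (μ.prod ν) := by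
  simpa only [cauchyTransform, integral_mul_const] using
    (integrable_cauchyKernel_mul_mul hμ hF hχ hB).integral_prod_left

theorem integrable_mul_cauchyTransform (hF : Integrable F (μ.prod ν)) {χ : ℂ × ℂ → ℂ}
    (hχ : AEStronglyMeasurable χ (μ.prod ν)) {B : ℝ} (hB : ∀ w, ‖χ w‖ ≤ B) :
    Integrable (fun w => F w * cauchyTransform μ χ w) (μ.prod ν) := by
  simpa only [cauchyTransform, integral_const_mul] using
    (integrable_mul_cauchyKernel_mul hμ hF hχ hB).integral_prod_left

theorem integral_cauchyTransform_mul (hF : Integrable F (μ.prod ν)) {χ : ℂ × ℂ → ℂ}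
    (hχ : AEStronglyMeasurable χ (μ.prod ν)) {B : ℝ} (hB : ∀ w, ‖χ w‖ ≤ B) :
    ∫ w, cauchyTransform μ F w * χ w ∂(μ.prod ν) =
      -∫ w, F w * cauchyTransform μ χ w ∂(μ.prod ν) := by
  set G : (ℂ × ℂ) × ℂ → ℂ := fun q => cauchyKernel (q.1.1 - q.2) * F (q.2, q.1.2) * χ q.1
  set H : (ℂ × ℂ) × ℂ → ℂ := fun q => F q.1 * (cauchyKernel (q.1.1 - q.2) * χ (q.2, q.1.2))
  have hexchange : ∀ q : (ℂ × ℂ) × ℂ, H ((q.2, q.1.2), q.1.1) = -G q := fun q => by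
    simp only [G, H, ← neg_sub q.1.1, cauchyKernel_neg]
    ring
  have hH := integrable_mul_cauchyKernel_mul hμ hF hχ hB
  calc ∫ w, cauchyTransform μ F w * χ w ∂(μ.prod ν)
      = ∫ q, G q ∂((μ.prod ν).prod μ) := by
        simp only [cauchyTransform, ← integral_mul_const]
        exact (integral_prod _ (integrable_cauchyKernel_mul_mul hμ hF hχ hB)).symm
    _ = -∫ q, H ((q.2, q.1.2), q.1.1) ∂((μ.prod ν).prod μ) := by
        simp only [hexchange, integral_neg, neg_neg]
    _ = -∫ q, H q ∂((μ.prod ν).prod μ) := by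
        have hmp := measurePreserving_exchange_fst μ ν
        conv_rhs => rw [← hmp.map_eq]
        rw [integral_map hmp.aemeasurable (by rw [hmp.map_eq]; exact hH.aestronglyMeasurable)]
    _ = -∫ w, F w * cauchyTransform μ χ w ∂(μ.prod ν) := by
        simp only [cauchyTransform, ← integral_const_mul]
        rw [integral_prod _ hH]

theorem ae_integrable_cauchyKernel_mul (hF : Integrable F (μ.prod ν)) :
    ∀ᵐ w ∂(μ.prod ν), Integrable (fun ζ => cauchyKernel (w.1 - ζ) * F (ζ, w.2)) μ := by
  simpa only [mul_one] using (integrable_cauchyKernel_mul_mul hμ hF (χ := fun _ => 1)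
    aestronglyMeasurable_const fun _ => norm_one.le).prod_right_ae

end CauchyTransform

section Cutoff

variable {E : Type*} [NormedAddCommGroup E] [InnerProductSpace ℝ E] [FiniteDimensional ℝ E]
  {U : Set E}

theorem exists_seq_cutoff (hU : IsOpen U) : ∃ κ : ℕ → E → ℝ,
    (∀ n, ContDiff ℝ ((⊤ : ℕ∞) : WithTop ℕ∞) (κ n)) ∧ (∀ n, HasCompactSupport (κ n)) ∧
    (∀ n, tsupport (κ n) ⊆ U) ∧ (∀ n z, κ n z ∈ Icc 0 1) ∧
    ∀ z ∈ U, ∀ᶠ n in atTop, κ n z = 1 := by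
  obtain ⟨f, hfU, hf, hf01⟩ := hU.exists_contDiff_support_eq (n := ⊤)
  -- Dividing by `1 + ‖z‖ ^ 2` makes the superlevel sets compact.
  set g : E → ℝ := fun z => f z / (1 + ‖z‖ ^ 2)
  have hg : ContDiff ℝ ((⊤ : ℕ∞) : WithTop ℕ∞) g :=
    hf.div (contDiff_const.add (contDiff_norm_sq ℝ)) fun z => by positivity
  have hg_pos : ∀ {z}, 0 < g z ↔ z ∈ U := fun {z} => by
    rw [div_pos_iff_of_pos_right (by positivity), ← hfU, Function.mem_support]
    exact (hf01 (mem_range_self z)).1.lt_iff_ne'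
  set κ : ℕ → E → ℝ := fun n z => Real.smoothTransition (n * g z - 1)
  have hκ_tsupport : ∀ n, tsupport (κ n) ⊆ {z | 1 ≤ n * g z} := fun n =>
    closure_minimal (fun z hz => le_of_not_gt fun h : n * g z < 1 =>
      hz (Real.smoothTransition.zero_of_nonpos (by linarith)))
      (isClosed_le continuous_const (continuous_const.mul hg.continuous))
  have hsuperlevel : ∀ n : ℕ, {z | 1 ≤ n * g z} ⊆ closedBall 0 n := fun n z hz => by
    have h1 : 1 + ‖z‖ ^ 2 ≤ n * f z := by
      have hz' : 1 ≤ n * (f z / (1 + ‖z‖ ^ 2)) := hz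
      rwa [← mul_div_assoc, one_le_div (by positivity)] at hz'
    have h2 : n * f z ≤ n := mul_le_of_le_one_right n.cast_nonneg (hf01 (mem_range_self z)).2
    rw [mem_closedBall_zero_iff]
    nlinarith [sq_nonneg (‖z‖ - 1)]
  refine ⟨κ, fun n => Real.smoothTransition.contDiff.comp (by fun_prop), fun n => ?_,
    fun n z hz => hg_pos.1 ?_,
    fun n z => ⟨Real.smoothTransition.nonneg _, Real.smoothTransition.le_one _⟩, fun z hz => ?_⟩
  · exact (isCompact_closedBall 0 (n : ℝ)).of_isClosed_subset (isClosed_tsupport _)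
      ((hκ_tsupport n).trans (hsuperlevel n))
  · exact pos_of_mul_pos_right (one_pos.trans_le (hκ_tsupport n hz)) n.cast_nonneg
  · filter_upwards [tendsto_natCast_atTop_atTop.eventually_ge_atTop (2 / g z)] with n hn
    have h2 : 2 ≤ n * g z := (div_le_iff₀ (hg_pos.2 hz)).1 hn
    exact Real.smoothTransition.one_of_one_le (by linarith)

theorem exists_iUnion_isCompact_eq (hU : IsOpen U) :
    ∃ K : ℕ → Set E, (∀ n, IsCompact (K n)) ∧ ⋃ n, K n = U := by
  obtain ⟨κ, -, hcompact, hsub, -, hone⟩ := exists_seq_cutoff hU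
  refine ⟨fun n => tsupport (κ n), hcompact, (iUnion_subset hsub).antisymm fun z hz => ?_⟩
  obtain ⟨n, hn⟩ := (hone z hz).exists
  exact mem_iUnion.2 ⟨n, subset_tsupport _ (by simp [hn])⟩

end Cutoff

section ProductDomain

variable {D₁ D₂ : Set ℂ} {F χ : ℂ × ℂ → ℂ}

/-- Integrability up to the boundary in the first variable and local integrability in the second:
`F` is integrable on `D₁ × K` for all compact `K ⊆ D₂`. -/
def IntegrableLocSnd (D₁ D₂ : Set ℂ) (F : ℂ × ℂ → ℂ) : Prop :=
  ∀ K ⊆ D₂, IsCompact K → IntegrableOn F (D₁ ×ˢ K)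

theorem IntegrableLocSnd.locallyIntegrableOn (hF : IntegrableLocSnd D₁ D₂ F) (h₁ : IsOpen D₁)
    (h₂ : IsOpen D₂) : LocallyIntegrableOn F (D₁ ×ˢ D₂) :=
  (locallyIntegrableOn_iff (h₁.prod h₂).isLocallyClosed).2 fun k hk hkc =>
    (hF (Prod.snd '' k) (image_subset_iff.2 fun _ hz => (hk hz).2)
      (hkc.image continuous_snd)).mono_set fun _ hz => ⟨(hk hz).1, mem_image_of_mem _ hz⟩

theorem restrict_prod_volume (D₁ K : Set ℂ) :
    (volume : Measure (ℂ × ℂ)).restrict (D₁ ×ˢ K) =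
      (volume.restrict D₁).prod (volume.restrict K) := by
  rw [Measure.volume_eq_prod, Measure.prod_restrict]

theorem cauchyTransform_restrict_eq (hχ : tsupport χ ⊆ D₁ ×ˢ D₂) :
    cauchyTransform (volume.restrict D₁) χ = cauchyTransform volume χ := by
  ext w
  refine setIntegral_eq_integral_of_forall_compl_eq_zero fun ζ hζ => ?_
  rw [image_eq_zero_of_notMem_tsupport fun h => hζ (hχ h).1, mul_zero]

theorem cauchyTransform_eq_zero {μ : Measure ℂ} {w : ℂ × ℂ} (hw : w.2 ∉ Prod.snd '' tsupport χ) :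
    cauchyTransform μ χ w = 0 := by
  refine integral_eq_zero_of_ae (Eventually.of_forall fun ζ => ?_)
  have hzero : χ (ζ, w.2) = 0 := image_eq_zero_of_notMem_tsupport fun h => hw ⟨_, h, rfl⟩
  simp only [hzero, mul_zero, Pi.zero_apply]

theorem setIntegral_prod_eq_of_snd {K : Set ℂ} {G : ℂ × ℂ → ℂ} (h₁ : IsOpen D₁) (h₂ : IsOpen D₂)
    (hK : K ⊆ D₂) (hG : ∀ z : ℂ × ℂ, z.2 ∉ K → G z = 0) :
    ∫ z in D₁ ×ˢ D₂, G z = ∫ z in D₁ ×ˢ K, G z :=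
  setIntegral_eq_of_subset_of_forall_sdiff_eq_zero (h₁.prod h₂).measurableSet
    (prod_mono_right hK) fun z hz => hG z fun h => hz.2 ⟨hz.1.1, h⟩

theorem IsTest.isCompact_image_snd {U : Set (ℂ × ℂ)} (hχ : IsTest U χ) :
    IsCompact (Prod.snd '' tsupport χ) :=
  hχ.2.1.isCompact.image continuous_snd

theorem IsTest.image_snd_subset (hχ : IsTest (D₁ ×ˢ D₂) χ) : Prod.snd '' tsupport χ ⊆ D₂ :=
  image_subset_iff.2 fun _ hz => (hχ.2.2 hz).2

theorem dbar₂_comp_fst_mul {κ : ℂ → ℂ} {g : ℂ × ℂ → ℂ} (hκ : Differentiable ℝ κ)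
    (hg : Differentiable ℝ g) (z : ℂ × ℂ) :
    dbar₂ (fun w => κ w.1 * g w) z = κ z.1 * dbar₂ g z := by
  have hκ_fst : Differentiable ℝ fun w : ℂ × ℂ => κ w.1 := hκ.comp differentiable_fst
  have hκ_dbar₂ : dbar₂ (fun w => κ w.1) z = 0 := by
    have hfderiv := (hκ z.1).hasFDerivAt.comp z (hasFDerivAt_fst (𝕜 := ℝ))
    simp [dbar₂, show fderiv ℝ (fun w : ℂ × ℂ => κ w.1) z = _ from hfderiv.fderiv]
  simp only [dbar₂_eq_dbarAlong] at hκ_dbar₂ ⊢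
  rw [dbarAlong_mul _ (hκ_fst z) (hg z), hκ_dbar₂, zero_mul, add_zero]

theorem IsTest.cutoff_mul_cauchyTransform (hχ : IsTest (D₁ ×ˢ D₂) χ) {κ : ℂ → ℝ}
    (hκ : ContDiff ℝ ((⊤ : ℕ∞) : WithTop ℕ∞) κ) (hcompact : HasCompactSupport κ)
    (hsub : tsupport κ ⊆ D₁) :
    IsTest (D₁ ×ˢ D₂) fun z => κ z.1 * cauchyTransform volume χ z := by
  have hK : IsCompact (tsupport κ ×ˢ (Prod.snd '' tsupport χ)) :=
    hcompact.isCompact.prod hχ.isCompact_image_snd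
  have hsupport : (Function.support fun z : ℂ × ℂ => κ z.1 * cauchyTransform volume χ z) ⊆
      tsupport κ ×ˢ (Prod.snd '' tsupport χ) := fun z hz =>
    ⟨subset_tsupport κ fun h => hz (by simp [h]),
      by_contra fun h => hz (by simp [cauchyTransform_eq_zero h])⟩
  exact ⟨((Complex.ofRealCLM.contDiff.comp hκ).comp contDiff_fst).mul
      (contDiff_cauchyTransform hχ.1 hχ.2.1),
    HasCompactSupport.of_support_subset_isCompact hK hsupport,
    (closure_minimal hsupport hK.isClosed).trans (prod_mono hsub hχ.image_snd_subset)⟩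

variable {C : ℝ≥0} (hC : ∀ x, ∫⁻ ζ in D₁, ‖cauchyKernel (x - ζ)‖ₑ ≤ C)
include hC

theorem integrableLocSnd_cauchyTransform (hF : IntegrableLocSnd D₁ D₂ F) :
    IntegrableLocSnd D₁ D₂ (cauchyTransform (volume.restrict D₁) F) := fun K hK hKc => by
  have hFK := hF K hK hKc
  rw [IntegrableOn, restrict_prod_volume] at hFK ⊢
  simpa only [mul_one] using integrable_cauchyTransform_mul hC hFK (χ := fun _ => 1)
    aestronglyMeasurable_const fun _ => norm_one.le

theorem IntegrableLocSnd.ae_integrableOn_cauchyKernel_mul (hF : IntegrableLocSnd D₁ D₂ F)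
    (h₂ : IsOpen D₂) : ∀ᵐ w ∂(volume.restrict (D₁ ×ˢ D₂)),
      IntegrableOn (fun ζ => cauchyKernel (w.1 - ζ) * F (ζ, w.2)) D₁ := by
  obtain ⟨K, hK, rfl⟩ := exists_iUnion_isCompact_eq h₂
  rw [prod_iUnion, ae_restrict_iUnion_iff]
  intro n
  have hFK := hF (K n) (subset_iUnion K n) (hK n)
  rw [IntegrableOn, restrict_prod_volume] at hFK
  rw [restrict_prod_volume]
  exact ae_integrable_cauchyKernel_mul hC hFK

theorem setIntegral_cauchyTransform_mul (hF : IntegrableLocSnd D₁ D₂ F) (h₁ : IsOpen D₁)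
    (h₂ : IsOpen D₂) (hχ : IsTest (D₁ ×ˢ D₂) χ) :
    ∫ w in D₁ ×ˢ D₂, cauchyTransform (volume.restrict D₁) F w * χ w =
      -∫ w in D₁ ×ˢ D₂, F w * cauchyTransform volume χ w := by
  have hFK := hF _ hχ.image_snd_subset hχ.isCompact_image_snd
  obtain ⟨B, hB⟩ := hχ.2.1.exists_bound_of_continuous hχ.1.continuous
  rw [setIntegral_prod_eq_of_snd h₁ h₂ hχ.image_snd_subset, setIntegral_prod_eq_of_snd h₁ h₂
    hχ.image_snd_subset, ← cauchyTransform_restrict_eq hχ.2.2]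
  · rw [IntegrableOn] at hFK
    rw [restrict_prod_volume] at hFK ⊢
    exact integral_cauchyTransform_mul hC hFK hχ.1.continuous.aestronglyMeasurable hB
  · intro z hz
    rw [cauchyTransform_eq_zero hz, mul_zero]
  · intro z hz
    rw [image_eq_zero_of_notMem_tsupport fun h => hz ⟨_, h, rfl⟩, mul_zero]

theorem integrableOn_mul_cauchyTransform (hF : IntegrableLocSnd D₁ D₂ F) (h₁ : IsOpen D₁)
    (h₂ : IsOpen D₂) (hχ : IsTest (D₁ ×ˢ D₂) χ) :
    IntegrableOn (fun w => F w * cauchyTransform volume χ w) (D₁ ×ˢ D₂) := by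
  have hFK := hF _ hχ.image_snd_subset hχ.isCompact_image_snd
  obtain ⟨B, hB⟩ := hχ.2.1.exists_bound_of_continuous hχ.1.continuous
  refine IntegrableOn.of_forall_sdiff_eq_zero (s := D₁ ×ˢ (Prod.snd '' tsupport χ)) ?_
    (h₁.prod h₂).measurableSet fun z hz => ?_
  · rw [← cauchyTransform_restrict_eq hχ.2.2]
    rw [IntegrableOn, restrict_prod_volume] at hFK ⊢
    exact integrable_mul_cauchyTransform hC hFK hχ.1.continuous.aestronglyMeasurable hB
  · rw [cauchyTransform_eq_zero fun h => hz.2 ⟨hz.1.1, h⟩, mul_zero]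

/- The transform of `χ` has compact support in the second variable only, so it is cut off in the
first one; a cutoff depending on `z₁` alone commutes with `∂/∂z̄₂`. -/
theorem setIntegral_mul_cauchyTransform_dbar₂ (hF : IntegrableLocSnd D₁ D₂ F) (h₁ : IsOpen D₁)
    (h₂ : IsOpen D₂) (hclosed : ∀ ψ, IsTest (D₁ ×ˢ D₂) ψ → ∫ z in D₁ ×ˢ D₂, F z * dbar₂ ψ z = 0)
    (hχ : IsTest (D₁ ×ˢ D₂) χ) :
    ∫ z in D₁ ×ˢ D₂, F z * cauchyTransform volume (dbar₂ χ) z = 0 := by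
  obtain ⟨κ, hκ, hκc, hκs, hκ01, hκ1⟩ := exists_seq_cutoff h₁
  have hint := integrableOn_mul_cauchyTransform hC hF h₁ h₂ (hχ.dbarAlong (.inr ℝ ℂ ℂ))
  rw [← dbar₂_eq_dbarAlong] at hint
  have hcutoff : ∀ n, ∫ z in D₁ ×ˢ D₂,
      κ n z.1 * (F z * cauchyTransform volume (dbar₂ χ) z) = 0 := fun n => by
    have hdbar₂ := dbar₂_comp_fst_mul
      ((Complex.ofRealCLM.contDiff.comp (hκ n)).differentiable (by simp))
      ((contDiff_cauchyTransform hχ.1 hχ.2.1).differentiable (by simp))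
    have hχ' := dbarAlong_cauchyTransform (hχ.1.of_le (by simp)) hχ.2.1 (.inr ℝ ℂ ℂ)
    simp only [← dbar₂_eq_dbarAlong] at hχ'
    rw [← hclosed _ (hχ.cutoff_mul_cauchyTransform (hκ n) (hκc n) (hκs n)), ← hχ']
    refine integral_congr_ae (Eventually.of_forall fun z => ?_)
    exact (mul_left_comm _ _ _).trans (congrArg (F z * ·) (hdbar₂ z).symm)
  refine tendsto_nhds_unique (tendsto_integral_of_dominated_convergence _ (fun n => ?_) hint.norm
    (fun n => Eventually.of_forall fun z => ?_) ?_)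
    (tendsto_const_nhds.congr fun n => (hcutoff n).symm)
  · exact ((Complex.continuous_ofReal.comp ((hκ n).continuous.comp
      continuous_fst)).aestronglyMeasurable).mul hint.aestronglyMeasurable
  · rw [norm_mul, Complex.norm_real, Real.norm_of_nonneg (hκ01 n z.1).1]
    exact mul_le_of_le_one_left (norm_nonneg _) (hκ01 n z.1).2
  · filter_upwards [ae_restrict_mem (h₁.prod h₂).measurableSet] with z hz
    refine tendsto_const_nhds.congr' ?_
    filter_upwards [hκ1 z.1 hz.1] with n hn
    rw [hn, Complex.ofReal_one, one_mul]

theorem isWeakSolution_cauchyTransform {f : Form01} (h₁ : IsOpen D₁) (h₂ : IsOpen D₂)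
    (hf : f.WeaklyClosed (D₁ ×ˢ D₂)) (hf₁ : IntegrableLocSnd D₁ D₂ f.c₁)
    (hf₂ : f.c₂ =ᵐ[volume.restrict (D₁ ×ˢ D₂)] 0) :
    IsWeakSolution (D₁ ×ˢ D₂) (cauchyTransform (volume.restrict D₁) f.c₁) f := by
  have hf₂_mul : ∀ g : ℂ × ℂ → ℂ, ∫ z in D₁ ×ˢ D₂, f.c₂ z * g z = 0 := fun g =>
    integral_eq_zero_of_ae (hf₂.mono fun z hz => by simp [hz])
  refine ⟨(integrableLocSnd_cauchyTransform hC hf₁).locallyIntegrableOn h₁ h₂, hf.1,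
    fun χ hχ => ⟨?_, ?_⟩⟩
  · rw [dbar₁_eq_dbarAlong, setIntegral_cauchyTransform_mul hC hf₁ h₁ h₂ (hχ.dbarAlong _),
      ← dbar₁_eq_dbarAlong, cauchyTransform_dbar₁ (hχ.1.of_le (by simp)) hχ.2.1]
  · rw [dbar₂_eq_dbarAlong, setIntegral_cauchyTransform_mul hC hf₁ h₁ h₂ (hχ.dbarAlong _),
      ← dbar₂_eq_dbarAlong, setIntegral_mul_cauchyTransform_dbar₂ hC hf₁ h₁ h₂
        (fun ψ hψ => (hf.2 ψ hψ).symm.trans (hf₂_mul _)) hχ, hf₂_mul]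

end ProductDomain

section OpT

variable {U : Set (ℂ × ℂ)} {f : Form01} {g h : ℂ × ℂ → ℂ}

theorem IsTest.integrableOn_mul {ψ : ℂ × ℂ → ℂ} (hψ : IsTest U ψ)
    (hg : LocallyIntegrableOn g U) : IntegrableOn (fun z => g z * ψ z) U := by
  have hK : IntegrableOn (fun z => g z * ψ z) (tsupport ψ) :=
    (hg.integrableOn_compact_subset hψ.2.2 hψ.2.1).mul_continuousOn hψ.1.continuous.continuousOn
      hψ.2.1
  refine (hK.integrable_of_forall_notMem_eq_zero fun z hz => ?_).integrableOn
  rw [image_eq_zero_of_notMem_tsupport hz, mul_zero]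

theorem IsScrD.ae_eq (hg : IsScrD U f g) (hh : IsScrD U f h) (hU : IsOpen U) :
    g =ᵐ[volume.restrict U] h := by
  have hsub : ∀ᵐ z, z ∈ U → (g - h) z = 0 := by
    refine hU.ae_eq_zero_of_integral_contDiff_smul_eq_zero (hg.2.1.sub hh.2.1) fun ψ hψ hc hs => ?_
    have htest : IsTest U fun z => (ψ z : ℂ) := ⟨Complex.ofRealCLM.contDiff.comp hψ,
      hc.comp_left Complex.ofReal_zero,
      (closure_mono (Function.support_comp_subset Complex.ofReal_zero ψ)).trans hs⟩
    have hreal : ∀ z, ψ z • (g - h) z = g z * ψ z - h z * ψ z := fun z => by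
      rw [Complex.real_smul, Pi.sub_apply, mul_sub, mul_comm (g z), mul_comm (h z)]
    have hout : ∀ z, z ∉ U → ψ z • (g - h) z = 0 := fun z hz => by
      rw [image_eq_zero_of_notMem_tsupport fun h => hz (hs h), zero_smul]
    rw [← setIntegral_eq_integral_of_forall_compl_eq_zero hout]
    simp only [hreal]
    rw [integral_sub (htest.integrableOn_mul hg.2.1) (htest.integrableOn_mul hh.2.1),
      hg.2.2 _ htest, hh.2.2 _ htest, sub_self]
  exact (ae_restrict_iff' hU.measurableSet).2 (hsub.mono fun z hz hzU => sub_eq_zero.1 (hz hzU))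

theorem isScrD_scrD (hex : ∃ g, IsScrD U f g) : IsScrD U f (scrD U f) := by
  rw [scrD, dif_pos hex]
  exact hex.choose_spec

theorem Form01.WeaklyClosed.isScrD_zero (hf : f.WeaklyClosed U)
    (hf₂ : f.c₂ =ᵐ[volume.restrict U] 0) : IsScrD U f 0 := by
  have hf₂_mul : ∀ g : ℂ × ℂ → ℂ, ∫ z in U, f.c₂ z * g z = 0 := fun g =>
    integral_eq_zero_of_ae (hf₂.mono fun z hz => by simp [hz])
  refine ⟨hf.1, locallyIntegrableOn_zero, fun ψ hψ => ?_⟩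
  simp [← hf.2 ψ hψ, hf₂_mul]

theorem IsWeakSolution.congr_ae {u v : ℂ × ℂ → ℂ} (hu : IsWeakSolution U u f) (hU : IsOpen U)
    (huv : u =ᵐ[volume.restrict U] v) : IsWeakSolution U v f := by
  have hmul : ∀ ψ : ℂ × ℂ → ℂ, ∫ z in U, v z * ψ z = ∫ z in U, u z * ψ z := fun ψ =>
    integral_congr_ae (huv.mono fun z hz => by simp [hz])
  refine ⟨?_, hu.2.1, fun ψ hψ => by simpa only [hmul] using hu.2.2 ψ hψ⟩
  rw [locallyIntegrableOn_iff hU.isLocallyClosed]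
  exact fun k hk hkc => (hu.1.integrableOn_compact_subset hk hkc).congr
    (ae_restrict_of_ae_restrict_of_subset hk huv)

variable {D₁ D₂ : Set ℂ}

theorem ae_ae_fst {P : ℂ × ℂ → Prop} (hP : ∀ᵐ z ∂(volume.restrict (D₁ ×ˢ D₂)), P z) :
    ∀ᵐ z ∂(volume.restrict (D₁ ×ˢ D₂)), ∀ᵐ ζ ∂(volume.restrict D₂), P (z.1, ζ) := by
  rw [restrict_prod_volume] at hP ⊢
  exact Measure.quasiMeasurePreserving_fst.ae (Measure.ae_ae_of_ae_prod hP)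

theorem div_sub_eq_cauchyKernel_mul (a ζ w : ℂ) :
    a / (ζ - w) = -Real.pi * (cauchyKernel (w - ζ) * a) := by
  have hpi : (Real.pi : ℂ) ≠ 0 := Complex.ofReal_ne_zero.2 Real.pi_ne_zero
  rw [cauchyKernel, ← neg_sub ζ w, mul_inv, inv_neg]
  field_simp

theorem opT_ae_eq_cauchyTransform (hf₂ : f.c₂ =ᵐ[volume.restrict (D₁ ×ˢ D₂)] 0)
    (hscrD : scrD (D₁ ×ˢ D₂) f =ᵐ[volume.restrict (D₁ ×ˢ D₂)] 0) :
    opT D₁ D₂ f =ᵐ[volume.restrict (D₁ ×ˢ D₂)]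
      cauchyTransform (volume.restrict D₁) f.c₁ := by
  have hterm₃ : ∀ z : ℂ × ℂ, ∫ ζ in D₁ ×ˢ D₂,
      scrD (D₁ ×ˢ D₂) f ζ / ((ζ.1 - z.1) * (ζ.2 - z.2)) = 0 := fun z =>
    integral_eq_zero_of_ae (hscrD.mono fun ζ hζ => by simp [hζ])
  filter_upwards [ae_ae_fst hf₂] with z hz
  have hterm₁ : ∫ ζ in D₂, f.c₂ (z.1, ζ) / (ζ - z.2) = 0 :=
    integral_eq_zero_of_ae (hz.mono fun ζ hζ => by simp [hζ])
  have hpi : (Real.pi : ℂ) ≠ 0 := Complex.ofReal_ne_zero.2 Real.pi_ne_zero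
  simp only [opT, cIntegral, cIntegral₂, hterm₁, hterm₃, mul_zero, zero_add, add_zero]
  simp only [div_sub_eq_cauchyKernel_mul, integral_const_mul, cauchyTransform]
  field_simp [Complex.I_ne_zero]

theorem opTWellDefined_of_c₂_ae_eq_zero {C : ℝ≥0}
    (hC : ∀ x, ∫⁻ ζ in D₁, ‖cauchyKernel (x - ζ)‖ₑ ≤ C) (h₂ : IsOpen D₂)
    (hf₁ : IntegrableLocSnd D₁ D₂ f.c₁) (hf₂ : f.c₂ =ᵐ[volume.restrict (D₁ ×ˢ D₂)] 0)
    (hisScrD : IsScrD (D₁ ×ˢ D₂) f (scrD (D₁ ×ˢ D₂) f))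
    (hscrD : scrD (D₁ ×ˢ D₂) f =ᵐ[volume.restrict (D₁ ×ˢ D₂)] 0) :
    OpTWellDefined D₁ D₂ f := by
  refine ⟨hisScrD, ?_⟩
  filter_upwards [ae_ae_fst hf₂, hf₁.ae_integrableOn_cauchyKernel_mul hC h₂] with z hz₂ hz₁
  refine ⟨integrableOn_zero.congr (hz₂.mono fun ζ hζ => by simp [hζ]), ?_,
    integrableOn_zero.congr (hscrD.mono fun ζ hζ => by simp [hζ])⟩
  simp only [div_sub_eq_cauchyKernel_mul]
  exact hz₁.const_mul _

end OpT

section Geometry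

theorem isOpen_disc : IsOpen disc := isOpen_lt continuous_norm continuous_const

theorem isOpen_puncturedDisc : IsOpen puncturedDisc :=
  (isOpen_lt continuous_const continuous_norm).inter (isOpen_lt continuous_norm continuous_const)

theorem isOpen_hartogs : IsOpen hartogs :=
  (isOpen_lt continuous_fst.norm continuous_snd.norm).inter
    (isOpen_lt continuous_snd.norm continuous_const)

theorem isOpen_disc_prod : IsOpen (disc ×ˢ puncturedDisc) :=
  isOpen_disc.prod isOpen_puncturedDisc

theorem ne_zero_of_mem_puncturedDisc {c : ℂ} (hc : c ∈ puncturedDisc) : c ≠ 0 :=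
  norm_pos_iff.1 hc.1

theorem snd_ne_zero_of_mem_hartogs {z : ℂ × ℂ} (hz : z ∈ hartogs) : z.2 ≠ 0 :=
  norm_pos_iff.1 ((norm_nonneg _).trans_lt hz.1)

theorem phi_phiInv {w : ℂ × ℂ} (hw : w.2 ≠ 0) : phi (phiInv w) = w := by
  simp [phi, phiInv, hw]

theorem phiInv_phi {z : ℂ × ℂ} (hz : z.2 ≠ 0) : phiInv (phi z) = z := by
  simp [phi, phiInv, hz]

theorem phiInv_mem_hartogs {w : ℂ × ℂ} (hw : w ∈ disc ×ˢ puncturedDisc) : phiInv w ∈ hartogs := by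
  refine ⟨?_, hw.2.2⟩
  rw [phiInv, norm_mul]
  exact mul_lt_of_lt_one_left hw.2.1 hw.1

theorem phi_mem {z : ℂ × ℂ} (hz : z ∈ hartogs) : phi z ∈ disc ×ˢ puncturedDisc := by
  have hpos : 0 < ‖z.2‖ := (norm_nonneg _).trans_lt hz.1
  refine ⟨?_, hpos, hz.2⟩
  change ‖z.1 / z.2‖ < 1
  rw [norm_div, div_lt_one hpos]
  exact hz.1

theorem leftInvOn_phi_phiInv : LeftInvOn phi phiInv (disc ×ˢ puncturedDisc) := fun _ hw =>
  phi_phiInv (ne_zero_of_mem_puncturedDisc hw.2)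

theorem leftInvOn_phiInv_phi : LeftInvOn phiInv phi hartogs := fun _ hz =>
  phiInv_phi (snd_ne_zero_of_mem_hartogs hz)

theorem image_phiInv : phiInv '' (disc ×ˢ puncturedDisc) = hartogs :=
  (image_subset_iff.2 fun _ => phiInv_mem_hartogs).antisymm fun z hz =>
    ⟨phi z, phi_mem hz, leftInvOn_phiInv_phi hz⟩

theorem contDiff_phiInv {n : WithTop ℕ∞} : ContDiff ℝ n phiInv :=
  (contDiff_fst.mul contDiff_snd).prodMk contDiff_snd

theorem contDiffOn_phi {n : WithTop ℕ∞} : ContDiffOn ℝ n phi hartogs :=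
  (contDiffOn_fst.mul (contDiffOn_snd.inv fun _ => snd_ne_zero_of_mem_hartogs)).prodMk
    contDiffOn_snd

end Geometry

section ChangeOfVariables

/-- The derivative of `phiInv` at `w`, as a complex-linear map. -/
def phiInvDeriv (w : ℂ × ℂ) : ℂ × ℂ →L[ℂ] ℂ × ℂ :=
  (w.1 • ContinuousLinearMap.snd ℂ ℂ ℂ + w.2 • ContinuousLinearMap.fst ℂ ℂ ℂ).prod
    (ContinuousLinearMap.snd ℂ ℂ ℂ)

theorem hasFDerivAt_phiInv (w : ℂ × ℂ) :
    HasFDerivAt phiInv ((phiInvDeriv w).restrictScalars ℝ) w :=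
  ((hasFDerivAt_fst.mul hasFDerivAt_snd).prodMk hasFDerivAt_snd : HasFDerivAt phiInv
    (phiInvDeriv w) w).restrictScalars ℝ

theorem abs_det_phiInvDeriv (w : ℂ × ℂ) :
    |((phiInvDeriv w).restrictScalars ℝ).det| = ‖w.2‖ ^ 2 := by
  have hdet : LinearMap.det (phiInvDeriv w : ℂ × ℂ →ₗ[ℂ] ℂ × ℂ) = w.2 := by
    rw [← LinearMap.det_toMatrix (Module.Basis.finTwoProd ℂ), Matrix.det_fin_two]
    simp [LinearMap.toMatrix_apply, phiInvDeriv]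
  rw [ContinuousLinearMap.det, ContinuousLinearMap.coe_restrictScalars,
    LinearMap.det_restrictScalars, hdet, Algebra.norm_complex_apply, Complex.normSq_eq_norm_sq,
    abs_of_nonneg (by positivity)]

instance : (volume : Measure (ℂ × ℂ)).IsAddHaarMeasure :=
  inferInstanceAs ((volume : Measure ℂ).prod volume).IsAddHaarMeasure

variable {s : Set (ℂ × ℂ)} {g u : ℂ × ℂ → ℂ}

theorem integrableOn_image_phiInv_iff (hs : MeasurableSet s) (hsub : s ⊆ disc ×ˢ puncturedDisc) :
    IntegrableOn g (phiInv '' s) ↔ IntegrableOn (fun w => ‖w.2‖ ^ 2 • g (phiInv w)) s := by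
  simpa only [abs_det_phiInvDeriv] using integrableOn_image_iff_integrableOn_abs_det_fderiv_smul
    volume hs (fun w _ => (hasFDerivAt_phiInv w).hasFDerivWithinAt)
    (leftInvOn_phi_phiInv.mono hsub).injOn g

theorem setIntegral_hartogs_eq (g : ℂ × ℂ → ℂ) :
    ∫ z in hartogs, g z = ∫ w in disc ×ˢ puncturedDisc, ‖w.2‖ ^ 2 • g (phiInv w) := by
  rw [← image_phiInv, integral_image_eq_integral_abs_det_fderiv_smul volume
    isOpen_disc_prod.measurableSet (fun w _ => (hasFDerivAt_phiInv w).hasFDerivWithinAt)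
    leftInvOn_phi_phiInv.injOn]
  simp only [abs_det_phiInvDeriv]

theorem integrableOn_comp_phiInv {K : Set ℂ} (hs : MeasurableSet s) (hsK : s ⊆ disc ×ˢ K)
    (hK : IsCompact K) (hKD : K ⊆ puncturedDisc) (hg : IntegrableOn g (phiInv '' s)) :
    IntegrableOn (g ∘ phiInv) s := by
  have hsub : s ⊆ disc ×ˢ puncturedDisc := hsK.trans (prod_mono_right hKD)
  have hne : ∀ w ∈ (univ : Set ℂ) ×ˢ K, ‖w.2‖ ^ 2 ≠ 0 := fun w hw =>
    pow_ne_zero 2 (norm_ne_zero_iff.2 (ne_zero_of_mem_puncturedDisc (hKD hw.2)))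
  have hcont : ContinuousOn (fun w : ℂ × ℂ => (‖w.2‖ ^ 2)⁻¹) (closedBall 0 1 ×ˢ K) :=
    (continuous_snd.norm.pow 2).continuousOn.inv₀ fun w hw => hne w ⟨mem_univ _, hw.2⟩
  have hsc : s ⊆ closedBall 0 1 ×ˢ K := fun w hw =>
    ⟨mem_closedBall_zero_iff.2 (hsK hw).1.le, (hsK hw).2⟩
  refine (((integrableOn_image_phiInv_iff hs hsub).1 hg).continuousOn_smul_of_subset hcont
    ((isCompact_closedBall 0 1).prod hK) hs hsc).congr_fun (fun w hw => ?_) hs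
  exact inv_smul_smul₀ (hne w ⟨mem_univ _, (hsK hw).2⟩) _

theorem locallyIntegrableOn_comp_phiInv (hg : LocallyIntegrableOn g hartogs) :
    LocallyIntegrableOn (g ∘ phiInv) (disc ×ˢ puncturedDisc) := by
  refine (locallyIntegrableOn_iff isOpen_disc_prod.isLocallyClosed).2 fun K hK hKc => ?_
  refine integrableOn_comp_phiInv hKc.measurableSet (K := Prod.snd '' K)
    (fun w hw => ⟨(hK hw).1, mem_image_of_mem _ hw⟩) (hKc.image continuous_snd)
    (image_subset_iff.2 fun w hw => (hK hw).2) ?_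
  exact hg.integrableOn_compact_subset (image_subset_iff.2 fun w hw => phiInv_mem_hartogs (hK hw))
    (hKc.image (contDiff_phiInv (n := 0)).continuous)

theorem locallyIntegrableOn_comp_phi (hu : LocallyIntegrableOn u (disc ×ˢ puncturedDisc)) :
    LocallyIntegrableOn (u ∘ phi) hartogs := by
  refine (locallyIntegrableOn_iff isOpen_hartogs.isLocallyClosed).2 fun K hK hKc => ?_
  have hsub : phi '' K ⊆ disc ×ˢ puncturedDisc := image_subset_iff.2 fun z hz => phi_mem (hK hz)
  have hcompact : IsCompact (phi '' K) :=
    hKc.image_of_continuousOn ((contDiffOn_phi (n := 0)).continuousOn.mono hK)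
  rw [← (leftInvOn_phiInv_phi.mono hK).image_image,
    integrableOn_image_phiInv_iff hcompact.measurableSet hsub]
  refine ((hu.integrableOn_compact_subset hsub hcompact).continuousOn_smul
    (f := fun w => ‖w.2‖ ^ 2) (by fun_prop) hcompact).congr_fun (fun w hw => ?_)
    hcompact.measurableSet
  simp only [Function.comp_apply, leftInvOn_phi_phiInv (hsub hw)]

/-- The image of Lebesgue measure on the Hartogs triangle under `phi`, written as a product measure:
the Jacobian `‖w₂‖²` of `phiInv` only involves the second factor. -/
def weightedProd : Measure (ℂ × ℂ) :=
  (volume.restrict disc).prod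
    ((volume.restrict puncturedDisc).withDensity fun c => ENNReal.ofReal (‖c‖ ^ 2))

theorem weightedProd_eq_withDensity : weightedProd =
    (volume.restrict (disc ×ˢ puncturedDisc)).withDensity
      fun w => ENNReal.ofReal (‖w.2‖ ^ 2) := by
  rw [weightedProd, prod_withDensity_right (by fun_prop), restrict_prod_volume]

theorem map_phiInv_weightedProd : weightedProd.map phiInv = volume.restrict hartogs := by
  rw [weightedProd_eq_withDensity, ← image_phiInv,
    ← map_withDensity_abs_det_fderiv_eq_addHaar volume isOpen_disc_prod.nullMeasurableSet
      (fun w _ => (hasFDerivAt_phiInv w).hasFDerivWithinAt) leftInvOn_phi_phiInv.injOn]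
  simp only [abs_det_phiInvDeriv]

theorem measurePreserving_phiInv :
    MeasurePreserving phiInv weightedProd (volume.restrict hartogs) :=
  ⟨(contDiff_phiInv (n := 0)).continuous.measurable, map_phiInv_weightedProd⟩

theorem ae_weightedProd_iff {P : ℂ × ℂ → Prop} :
    (∀ᵐ w ∂weightedProd, P w) ↔ ∀ᵐ w ∂(volume.restrict (disc ×ˢ puncturedDisc)), P w := by
  rw [weightedProd_eq_withDensity, ae_withDensity_iff (by fun_prop)]
  refine ⟨fun h => ?_, fun h => h.mono fun w hw _ => hw⟩
  filter_upwards [h, ae_restrict_mem isOpen_disc_prod.measurableSet] with w hw hmem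
  have hpos : 0 < ‖w.2‖ ^ 2 := pow_pos hmem.2.1 2
  exact hw (ENNReal.ofReal_pos.2 hpos).ne'

theorem measurePreserving_phi :
    MeasurePreserving phi (volume.restrict hartogs) weightedProd := by
  have hmeas : Measurable phi := (measurable_fst.div measurable_snd).prodMk measurable_snd
  refine ⟨hmeas, ?_⟩
  rw [← map_phiInv_weightedProd, Measure.map_map hmeas measurePreserving_phiInv.measurable,
    Measure.map_congr (g := id), Measure.map_id]
  exact ae_weightedProd_iff.2 ((ae_restrict_mem isOpen_disc_prod.measurableSet).mono
    fun w hw => leftInvOn_phi_phiInv hw)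

end ChangeOfVariables

section Pullback

variable {E : Type*} [NormedAddCommGroup E] [NormedSpace ℂ E]

theorem dbarAlong_eq_zero_of_differentiableAt (ι : ℂ →L[ℂ] E) {g : E → ℂ} {z : E}
    (hg : DifferentiableAt ℂ g z) :
    dbarAlong (ι.restrictScalars ℝ) g z = 0 := by
  have hlin : fderiv ℂ g z (ι Complex.I) = Complex.I * fderiv ℂ g z (ι 1) := by
    rw [← smul_eq_mul, ← map_smul, ← map_smul, smul_eq_mul, mul_one]
  rw [dbarAlong, hg.fderiv_restrictScalars ℝ, conjCoeff]
  simp only [ContinuousLinearMap.comp_apply, ContinuousLinearMap.coe_restrictScalars', hlin]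
  linear_combination (1 / 2) * fderiv ℂ g z (ι 1) * Complex.I_mul_I

theorem dbarAlong_mul_of_differentiableAt (ι : ℂ →L[ℂ] E) {g χ : E → ℂ} {z : E}
    (hg : DifferentiableAt ℂ g z) (hχ : DifferentiableAt ℝ χ z) :
    dbarAlong (ι.restrictScalars ℝ) (fun w => g w * χ w) z =
      g z * dbarAlong (ι.restrictScalars ℝ) χ z := by
  rw [dbarAlong_mul _ (hg.restrictScalars ℝ) hχ, dbarAlong_eq_zero_of_differentiableAt ι hg,
    zero_mul, add_zero]

theorem dbarAlong_conj_mul (ι : ℂ →L[ℝ] E) (π : E →L[ℝ] ℂ)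
    (hπ : π.comp ι = ContinuousLinearMap.id ℝ ℂ) {χ : E → ℂ} {z : E}
    (hχ : DifferentiableAt ℝ χ z) :
    dbarAlong ι (fun w => conj (π w) * χ w) z = conj (π z) * dbarAlong ι χ z + χ z := by
  have hderiv : HasFDerivAt (fun w => conj (π w)) ((Complex.conjCLE : ℂ →L[ℝ] ℂ).comp π) z :=
    ((Complex.conjCLE : ℂ →L[ℝ] ℂ).comp π).hasFDerivAt
  have hone : dbarAlong ι (fun w => conj (π w)) z = 1 := by
    rw [dbarAlong, hderiv.fderiv, ContinuousLinearMap.comp_assoc, hπ]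
    norm_num [conjCoeff]
  rw [dbarAlong_mul _ hderiv.differentiableAt hχ, hone, one_mul]

variable {ψ χ : ℂ × ℂ → ℂ} {w : ℂ × ℂ}

theorem dbar₁_comp_phiInv (hψ : DifferentiableAt ℝ ψ (phiInv w)) :
    dbar₁ (ψ ∘ phiInv) w = conj w.2 * dbar₁ ψ (phiInv w) := by
  have hinl : ((phiInvDeriv w).restrictScalars ℝ).comp (ContinuousLinearMap.inl ℝ ℂ ℂ) =
      (ContinuousLinearMap.inl ℝ ℂ ℂ).comp (ContinuousLinearMap.mul ℝ ℂ w.2) := by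
    ext <;> simp [phiInvDeriv]
  rw [dbar₁_eq_dbarAlong, dbarAlong, fderiv_comp w hψ (hasFDerivAt_phiInv w).differentiableAt,
    (hasFDerivAt_phiInv w).fderiv, ContinuousLinearMap.comp_assoc, hinl,
    ← ContinuousLinearMap.comp_assoc, conjCoeff_comp_mul, dbar₁_eq_dbarAlong, dbarAlong]

theorem dbar₂_comp_phiInv (hψ : DifferentiableAt ℝ ψ (phiInv w)) :
    dbar₂ (ψ ∘ phiInv) w = conj w.1 * dbar₁ ψ (phiInv w) + dbar₂ ψ (phiInv w) := by
  have hinr : ((phiInvDeriv w).restrictScalars ℝ).comp (ContinuousLinearMap.inr ℝ ℂ ℂ) =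
      (ContinuousLinearMap.inl ℝ ℂ ℂ).comp (ContinuousLinearMap.mul ℝ ℂ w.1) +
        ContinuousLinearMap.inr ℝ ℂ ℂ := by
    ext <;> simp [phiInvDeriv]
  have hadd : ∀ L M : ℂ →L[ℝ] ℂ, conjCoeff (L + M) = conjCoeff L + conjCoeff M := fun L M => by
    simp only [conjCoeff, _root_.add_apply]
    ring
  rw [dbar₂_eq_dbarAlong, dbarAlong, fderiv_comp w hψ (hasFDerivAt_phiInv w).differentiableAt,
    (hasFDerivAt_phiInv w).fderiv, ContinuousLinearMap.comp_assoc, hinr,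
    ContinuousLinearMap.comp_add, hadd, ← ContinuousLinearMap.comp_assoc, conjCoeff_comp_mul]
  rfl

theorem IsTest.differentiable {U : Set (ℂ × ℂ)} (hχ : IsTest U χ) : Differentiable ℝ χ :=
  hχ.1.differentiable (by simp)

theorem isTest_of_support_subset {U K : Set (ℂ × ℂ)} (hK : IsCompact K) (hKU : K ⊆ U)
    (hsupp : Function.support χ ⊆ K) (hχ : ContDiffOn ℝ ((⊤ : ℕ∞) : WithTop ℕ∞) χ U)
    (hU : IsOpen U) : IsTest U χ := by
  have hsub : tsupport χ ⊆ U := (closure_minimal hsupp hK.isClosed).trans hKU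
  refine ⟨contDiff_iff_contDiffAt.2 fun z => ?_, .of_support_subset_isCompact hK hsupp, hsub⟩
  by_cases hz : z ∈ tsupport χ
  · exact hχ.contDiffAt (hU.mem_nhds (hsub hz))
  · exact contDiffAt_const.congr_of_eventuallyEq (notMem_tsupport_iff_eventuallyEq.1 hz)

theorem IsTest.mul_of_contDiffOn {U : Set (ℂ × ℂ)} (hχ : IsTest U χ) (hU : IsOpen U)
    {g : ℂ × ℂ → ℂ} (hg : ContDiffOn ℝ ((⊤ : ℕ∞) : WithTop ℕ∞) g U) :
    IsTest U fun z => g z * χ z :=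
  isTest_of_support_subset hχ.2.1 hχ.2.2
    ((Function.support_mul_subset_right g χ).trans (subset_tsupport χ))
    (hg.mul hχ.1.contDiffOn) hU

theorem IsTest.comp_of_leftInvOn {U V : Set (ℂ × ℂ)} {Φ Ψ : ℂ × ℂ → ℂ × ℂ} (hχ : IsTest U χ)
    (hV : IsOpen V) (hΦ : ContDiffOn ℝ ((⊤ : ℕ∞) : WithTop ℕ∞) Φ V) (hpre : Φ ⁻¹' U ⊆ V)
    (hΨ : ContinuousOn Ψ U) (hmaps : MapsTo Ψ U V) (hinv : LeftInvOn Ψ Φ V) :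
    IsTest V (χ ∘ Φ) :=
  isTest_of_support_subset (hχ.2.1.isCompact.image_of_continuousOn (hΨ.mono hχ.2.2))
    (image_subset_iff.2 fun _ hw => hmaps (hχ.2.2 hw))
    (fun z hz =>
      have hmem : Φ z ∈ tsupport χ := subset_tsupport _ hz
      ⟨Φ z, hmem, hinv (hpre (hχ.2.2 hmem))⟩)
    (hχ.1.comp_contDiffOn hΦ) hV

theorem preimage_phiInv_hartogs_subset : phiInv ⁻¹' hartogs ⊆ disc ×ˢ puncturedDisc := by
  intro w hw
  have hw₂ : w.2 ≠ 0 := snd_ne_zero_of_mem_hartogs (z := phiInv w) hw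
  rw [← phi_phiInv hw₂]
  exact phi_mem hw

theorem preimage_phi_prod_subset : phi ⁻¹' (disc ×ˢ puncturedDisc) ⊆ hartogs := fun z hz => by
  rw [← phiInv_phi (ne_zero_of_mem_puncturedDisc (c := z.2) hz.2)]
  exact phiInv_mem_hartogs hz

theorem IsTest.comp_phiInv (hψ : IsTest hartogs ψ) :
    IsTest (disc ×ˢ puncturedDisc) (ψ ∘ phiInv) :=
  hψ.comp_of_leftInvOn isOpen_disc_prod contDiff_phiInv.contDiffOn preimage_phiInv_hartogs_subset
    (contDiffOn_phi (n := 0)).continuousOn (fun _ => phi_mem) leftInvOn_phi_phiInv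

theorem IsTest.comp_phi (hχ : IsTest (disc ×ˢ puncturedDisc) χ) : IsTest hartogs (χ ∘ phi) :=
  hχ.comp_of_leftInvOn isOpen_hartogs contDiffOn_phi preimage_phi_prod_subset
    (contDiff_phiInv (n := 0)).continuous.continuousOn (fun _ => phiInv_mem_hartogs)
    leftInvOn_phiInv_phi

end Pullback

section Transfer

/-- The test function on the product that corresponds to the test function `ψ` on the Hartogs
triangle. Only the holomorphic factor `w₂` of the Jacobian `w₂ w̄₂` is included, so that the
`∂̄`-derivatives pass through it. -/
def twist (ψ : ℂ × ℂ → ℂ) (w : ℂ × ℂ) : ℂ := w.2 * ψ (phiInv w)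

variable {ψ χ g u : ℂ × ℂ → ℂ} {α : Form01}

theorem setIntegral_hartogs_mul (g ψ : ℂ × ℂ → ℂ) :
    ∫ z in hartogs, g z * ψ z =
      ∫ w in disc ×ˢ puncturedDisc, conj w.2 * g (phiInv w) * twist ψ w := by
  have hsq : ∀ c : ℂ, ((‖c‖ ^ 2 : ℝ) : ℂ) = conj c * c := fun c => by
    rw [← Complex.normSq_eq_norm_sq, Complex.normSq_eq_conj_mul_self]
  rw [setIntegral_hartogs_eq]
  refine integral_congr_ae (.of_forall fun w => ?_)
  simp only [Complex.real_smul, hsq, twist]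
  ring

theorem dbar₁_twist (hψ : Differentiable ℝ ψ) (w : ℂ × ℂ) :
    dbar₁ (twist ψ) w = conj w.2 * twist (dbar₁ ψ) w := by
  have hmul : dbar₁ (twist ψ) w = w.2 * dbar₁ (ψ ∘ phiInv) w :=
    dbarAlong_mul_of_differentiableAt (.inl ℂ ℂ ℂ) (g := Prod.snd) differentiableAt_snd
      ((hψ _).comp w (hasFDerivAt_phiInv w).differentiableAt)
  rw [hmul, dbar₁_comp_phiInv (hψ _), twist]
  ring

theorem dbar₂_twist (hψ : Differentiable ℝ ψ) (w : ℂ × ℂ) :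
    dbar₂ (twist ψ) w = conj w.1 * twist (dbar₁ ψ) w + twist (dbar₂ ψ) w := by
  have hmul : dbar₂ (twist ψ) w = w.2 * dbar₂ (ψ ∘ phiInv) w :=
    dbarAlong_mul_of_differentiableAt (.inr ℂ ℂ ℂ) (g := Prod.snd) differentiableAt_snd
      ((hψ _).comp w (hasFDerivAt_phiInv w).differentiableAt)
  rw [hmul, dbar₂_comp_phiInv (hψ _), twist, twist]
  ring

theorem isTest_twist (hψ : IsTest hartogs ψ) : IsTest (disc ×ˢ puncturedDisc) (twist ψ) :=
  hψ.comp_phiInv.mul_of_contDiffOn isOpen_disc_prod contDiffOn_snd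

theorem IsTest.exists_twist_eq (hχ : IsTest (disc ×ˢ puncturedDisc) χ) :
    ∃ ψ, IsTest hartogs ψ ∧ twist ψ = χ := by
  refine ⟨fun z => z.2⁻¹ * (χ ∘ phi) z, hχ.comp_phi.mul_of_contDiffOn isOpen_hartogs
    (contDiffOn_snd.inv fun _ => snd_ne_zero_of_mem_hartogs), funext fun w => ?_⟩
  by_cases hw : w.2 = 0
  · have hmem : w ∉ tsupport χ := fun h => ne_zero_of_mem_puncturedDisc (hχ.2.2 h).2 hw
    rw [twist, hw, zero_mul, image_eq_zero_of_notMem_tsupport hmem]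
  · rw [twist, Function.comp_apply, phi_phiInv hw]
    exact mul_inv_cancel_left₀ hw _

theorem setIntegral_hartogs_mul_dbar₁ (hψ : Differentiable ℝ ψ) (g : ℂ × ℂ → ℂ) :
    ∫ z in hartogs, g z * dbar₁ ψ z =
      ∫ w in disc ×ˢ puncturedDisc, g (phiInv w) * dbar₁ (twist ψ) w := by
  rw [setIntegral_hartogs_mul]
  refine integral_congr_ae (.of_forall fun w => ?_)
  simp only [dbar₁_twist hψ]
  ring

theorem setIntegral_hartogs_mul_dbar₂ (hψ : Differentiable ℝ ψ) (g : ℂ × ℂ → ℂ) :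
    ∫ z in hartogs, g z * dbar₂ ψ z =
      ∫ w in disc ×ˢ puncturedDisc, g (phiInv w) *
        (conj w.2 * dbar₂ (twist ψ) w - conj w.1 * dbar₁ (twist ψ) w) := by
  rw [setIntegral_hartogs_mul]
  refine integral_congr_ae (.of_forall fun w => ?_)
  simp only [dbar₁_twist hψ, dbar₂_twist hψ]
  ring

theorem transfer_c₂_ae_eq_zero
    (hα : ∀ᵐ z ∂(volume.restrict hartogs), conj z.1 * α.c₁ z + conj z.2 * α.c₂ z = 0) :
    (transfer α).c₂ =ᵐ[volume.restrict (disc ×ˢ puncturedDisc)] 0 := by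
  filter_upwards [ae_weightedProd_iff.1 (measurePreserving_phiInv.quasiMeasurePreserving.ae hα),
    ae_restrict_mem isOpen_disc_prod.measurableSet] with w hw hmem
  have hne : conj w.2 ≠ 0 := (map_ne_zero _).2 (ne_zero_of_mem_puncturedDisc hmem.2)
  refine (mul_eq_zero_iff_left hne).1 ?_
  simp only [phiInv, map_mul] at hw
  simp only [transfer, phiInv]
  linear_combination hw

theorem locallyIntegrableOn_conj_mul_comp_phiInv (hg : LocallyIntegrableOn g hartogs)
    {π : ℂ × ℂ → ℂ} (hπ : Continuous π) :
    LocallyIntegrableOn (fun w => conj (π w) * g (phiInv w)) (disc ×ˢ puncturedDisc) := by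
  have hconj : Continuous fun w => conj (π w) := Complex.continuous_conj.comp hπ
  exact (locallyIntegrableOn_comp_phiInv hg).continuousOn_mul hconj.continuousOn
    isOpen_disc_prod.isLocallyClosed

theorem locInt_transfer (hα : α.LocInt hartogs) :
    (transfer α).LocInt (disc ×ˢ puncturedDisc) :=
  ⟨locallyIntegrableOn_conj_mul_comp_phiInv hα.1 continuous_snd,
    (locallyIntegrableOn_conj_mul_comp_phiInv hα.1 continuous_fst).add
      (locallyIntegrableOn_comp_phiInv hα.2)⟩

theorem dbar₁_conj_fst_mul {z : ℂ × ℂ} (hχ : DifferentiableAt ℝ χ z) :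
    dbar₁ (fun w => conj w.1 * χ w) z = conj z.1 * dbar₁ χ z + χ z :=
  dbarAlong_conj_mul (.inl ℝ ℂ ℂ) (.fst ℝ ℂ ℂ) rfl hχ

theorem dbar₂_conj_snd_mul {z : ℂ × ℂ} (hχ : DifferentiableAt ℝ χ z) :
    dbar₂ (fun w => conj w.2 * χ w) z = conj z.2 * dbar₂ χ z + χ z :=
  dbarAlong_conj_mul (.inr ℝ ℂ ℂ) (.snd ℝ ℂ ℂ) rfl hχ

theorem IsTest.conj_fst_mul {U : Set (ℂ × ℂ)} (hχ : IsTest U χ) (hU : IsOpen U) :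
    IsTest U fun w => conj w.1 * χ w :=
  hχ.mul_of_contDiffOn hU (Complex.conjCLE.contDiff.comp contDiff_fst).contDiffOn

theorem IsTest.conj_snd_mul {U : Set (ℂ × ℂ)} (hχ : IsTest U χ) (hU : IsOpen U) :
    IsTest U fun w => conj w.2 * χ w :=
  hχ.mul_of_contDiffOn hU (Complex.conjCLE.contDiff.comp contDiff_snd).contDiffOn

theorem IsTest.dbar₁ {U : Set (ℂ × ℂ)} (hχ : IsTest U χ) : IsTest U (dbar₁ χ) :=
  hχ.dbarAlong (.inl ℝ ℂ ℂ)

theorem IsTest.dbar₂ {U : Set (ℂ × ℂ)} (hχ : IsTest U χ) : IsTest U (dbar₂ χ) :=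
  hχ.dbarAlong (.inr ℝ ℂ ℂ)

theorem weaklyClosed_transfer (hα : α.WeaklyClosed hartogs) :
    (transfer α).WeaklyClosed (disc ×ˢ puncturedDisc) := by
  have hf := locInt_transfer hα.1
  refine ⟨hf, fun χ hχ => ?_⟩
  obtain ⟨ψ, hψ, rfl⟩ := hχ.exists_twist_eq
  have hcross := hχ.dbar₁.integrableOn_mul
    (locallyIntegrableOn_conj_mul_comp_phiInv hα.1.1 continuous_fst)
  have hclosed := hα.2 ψ hψ
  rw [setIntegral_hartogs_mul_dbar₁ hψ.differentiable,
    setIntegral_hartogs_mul_dbar₂ hψ.differentiable] at hclosed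
  have hleft : ∫ w in disc ×ˢ puncturedDisc, (transfer α).c₂ w * dbar₁ (twist ψ) w =
      (∫ w in disc ×ˢ puncturedDisc, conj w.1 * α.c₁ (phiInv w) * dbar₁ (twist ψ) w) +
        ∫ w in disc ×ˢ puncturedDisc, α.c₂ (phiInv w) * dbar₁ (twist ψ) w := by
    simp only [transfer, add_mul]
    exact integral_add hcross
      (hχ.dbar₁.integrableOn_mul (locallyIntegrableOn_comp_phiInv hα.1.2))
  rw [hleft, hclosed, ← eq_sub_iff_add_eq',
    ← integral_sub (hχ.dbar₂.integrableOn_mul hf.1) hcross]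
  refine integral_congr_ae (.of_forall fun w => ?_)
  simp only [transfer]
  ring

theorem setIntegral_comp_phi_comp_phiInv_mul (u k : ℂ × ℂ → ℂ) :
    ∫ w in disc ×ˢ puncturedDisc, (u ∘ phi) (phiInv w) * k w =
      ∫ w in disc ×ˢ puncturedDisc, u w * k w :=
  setIntegral_congr_fun isOpen_disc_prod.measurableSet fun w hw => by
    simp only [Function.comp_apply, leftInvOn_phi_phiInv hw]

theorem setIntegral_comp_phi_mul_dbar₂ (hu : LocallyIntegrableOn u (disc ×ˢ puncturedDisc))
    (hψ : IsTest hartogs ψ) :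
    ∫ z in hartogs, (u ∘ phi) z * dbar₂ ψ z =
      (∫ w in disc ×ˢ puncturedDisc, u w * dbar₂ (fun w => conj w.2 * twist ψ w) w) -
        ∫ w in disc ×ˢ puncturedDisc, u w * dbar₁ (fun w => conj w.1 * twist ψ w) w := by
  have hη := isTest_twist hψ
  rw [setIntegral_hartogs_mul_dbar₂ hψ.differentiable, setIntegral_comp_phi_comp_phiInv_mul,
    ← integral_sub
      ((hη.conj_snd_mul isOpen_disc_prod).dbar₂.integrableOn_mul hu)
      ((hη.conj_fst_mul isOpen_disc_prod).dbar₁.integrableOn_mul hu)]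
  refine integral_congr_ae (.of_forall fun w => ?_)
  simp only [dbar₁_conj_fst_mul (hη.differentiable w), dbar₂_conj_snd_mul (hη.differentiable w)]
  ring

theorem IsWeakSolution.comp_phi (hu : IsWeakSolution (disc ×ˢ puncturedDisc) u (transfer α))
    (hα : α.LocInt hartogs) : IsWeakSolution hartogs (u ∘ phi) α := by
  obtain ⟨hu_loc, hf, hu_eq⟩ := hu
  refine ⟨locallyIntegrableOn_comp_phi hu_loc, hα, fun ψ hψ => ?_⟩
  have hη := isTest_twist hψ
  have hfst := hη.conj_fst_mul isOpen_disc_prod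
  have hsnd := hη.conj_snd_mul isOpen_disc_prod
  constructor
  · rw [setIntegral_hartogs_mul_dbar₁ hψ.differentiable, setIntegral_comp_phi_comp_phiInv_mul,
      (hu_eq _ hη).1, setIntegral_hartogs_mul]
    rfl
  · rw [setIntegral_comp_phi_mul_dbar₂ hu_loc hψ, (hu_eq _ hfst).1, (hu_eq _ hsnd).2,
      setIntegral_hartogs_mul, ← neg_add', ← sub_eq_add_neg,
      ← integral_sub (hsnd.integrableOn_mul hf.2) (hfst.integrableOn_mul hf.1)]
    congr 1
    refine integral_congr_ae (.of_forall fun w => ?_)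
    simp only [transfer]
    ring

theorem volume_disc_ne_top : volume disc ≠ ∞ :=
  ((measure_mono fun _ => mem_ball_zero_iff.2).trans_lt (measure_ball_lt_top (r := 1))).ne

instance : IsFiniteMeasure (volume.restrict hartogs) := by
  refine isFiniteMeasure_restrict.2 ((measure_mono fun z hz => ?_).trans_lt
    (measure_ball_lt_top (x := (0 : ℂ × ℂ)) (r := 1))).ne
  exact mem_ball_zero_iff.2 (max_lt (hz.1.trans hz.2) hz.2)

theorem integrableLocSnd_transfer_c₁ (hα : IntegrableOn α.c₁ hartogs) :
    IntegrableLocSnd disc puncturedDisc (transfer α).c₁ := by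
  intro K hKD hK
  have hs : MeasurableSet (disc ×ˢ K) := isOpen_disc.measurableSet.prod hK.measurableSet
  have hsub : phiInv '' (disc ×ˢ K) ⊆ hartogs :=
    image_subset_iff.2 fun w hw => phiInv_mem_hartogs ⟨hw.1, hKD hw.2⟩
  have hconj : Continuous fun w : ℂ × ℂ => conj w.2 := by fun_prop
  exact (integrableOn_comp_phiInv hs Subset.rfl hK hKD
    (hα.mono_set hsub)).continuousOn_mul_of_subset hconj.continuousOn
    ((isCompact_closedBall 0 1).prod hK) hs
    (prod_mono_left fun ζ hζ => mem_closedBall_zero_iff.2 (le_of_lt hζ))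

theorem eLpNorm_cauchyTransform_transfer_comp_phi_le {C : ℝ≥0}
    (hC : ∀ x, ∫⁻ ζ in disc, ‖cauchyKernel (x - ζ)‖ₑ ≤ C) {p : ℝ≥0∞} (hp : 1 ≤ p)
    (hα : AEStronglyMeasurable α.c₁ (volume.restrict hartogs)) :
    eLpNorm (cauchyTransform (volume.restrict disc) (transfer α).c₁ ∘ phi) p
      (volume.restrict hartogs) ≤ C * eLpNorm α.c₁ p (volume.restrict hartogs) := by
  have hα' : AEStronglyMeasurable (α.c₁ ∘ phiInv) weightedProd :=
    hα.comp_measurePreserving measurePreserving_phiInv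
  have hconj : Continuous fun w : ℂ × ℂ => conj w.2 := by fun_prop
  have hf : AEStronglyMeasurable (transfer α).c₁ weightedProd :=
    hconj.aestronglyMeasurable.mul hα'
  have hle : ∀ᵐ w ∂weightedProd, ‖(transfer α).c₁ w‖ ≤ ‖(α.c₁ ∘ phiInv) w‖ := by
    refine ae_weightedProd_iff.2 ?_
    filter_upwards [ae_restrict_mem isOpen_disc_prod.measurableSet] with w hw
    rw [transfer, norm_mul, RCLike.norm_conj]
    exact mul_le_of_le_one_left (norm_nonneg _) hw.2.2.le
  calc eLpNorm (cauchyTransform (volume.restrict disc) (transfer α).c₁ ∘ phi) p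
        (volume.restrict hartogs)
    _ = eLpNorm (cauchyTransform (volume.restrict disc) (transfer α).c₁) p weightedProd :=
      eLpNorm_comp_measurePreserving (aestronglyMeasurable_cauchyTransform hf)
        measurePreserving_phi
    _ ≤ C * eLpNorm (transfer α).c₁ p weightedProd := eLpNorm_cauchyTransform_le hC hf hp
    _ ≤ C * eLpNorm (α.c₁ ∘ phiInv) p weightedProd := by gcongr; exact eLpNorm_mono_ae hle
    _ = C * eLpNorm α.c₁ p (volume.restrict hartogs) := by
      rw [eLpNorm_comp_measurePreserving hα measurePreserving_phiInv]

end Transfer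

end

end HartogsDbar

open HartogsDbar in
theorem theorem5p2_general :
    ∃ C : ℝ≥0, 0 < C ∧ ∀ p : ℝ≥0∞, 1 ≤ p → ∀ α : HartogsDbar.Form01,
      α.WeaklyClosed HartogsDbar.hartogs →
      (∀ᵐ z ∂(volume.restrict HartogsDbar.hartogs),
        conj z.1 * α.c₁ z + conj z.2 * α.c₂ z = 0) →
      MemLp α.c₁ p (volume.restrict HartogsDbar.hartogs) →
      HartogsDbar.OpTWellDefined HartogsDbar.disc HartogsDbar.puncturedDisc
          (HartogsDbar.transfer α) ∧
      HartogsDbar.IsWeakSolution HartogsDbar.hartogs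
        (HartogsDbar.opT HartogsDbar.disc HartogsDbar.puncturedDisc
          (HartogsDbar.transfer α) ∘ HartogsDbar.phi) α ∧
      MemLp (HartogsDbar.opT HartogsDbar.disc HartogsDbar.puncturedDisc
          (HartogsDbar.transfer α) ∘ HartogsDbar.phi) p
        (volume.restrict HartogsDbar.hartogs) ∧
      eLpNorm (HartogsDbar.opT HartogsDbar.disc HartogsDbar.puncturedDisc
          (HartogsDbar.transfer α) ∘ HartogsDbar.phi) p
          (volume.restrict HartogsDbar.hartogs) ≤
        C * eLpNorm α.c₁ p (volume.restrict HartogsDbar.hartogs) := by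
  obtain ⟨C, hC⟩ := exists_lintegral_cauchyKernel_sub_le volume_disc_ne_top
  refine ⟨C + 1, by positivity, fun p hp α hclosed hα hLp => ?_⟩
  have hf := weaklyClosed_transfer hclosed
  have hf₁ := integrableLocSnd_transfer_c₁ (hLp.integrable hp)
  have hf₂ := transfer_c₂_ae_eq_zero hα
  have hisScrD := isScrD_scrD ⟨0, hf.isScrD_zero hf₂⟩
  have hscrD := hisScrD.ae_eq (hf.isScrD_zero hf₂) isOpen_disc_prod
  have hT := opT_ae_eq_cauchyTransform hf₂ hscrD
  have hTphi := measurePreserving_phi.quasiMeasurePreserving.ae_eq_comp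
    (ae_weightedProd_iff.2 hT)
  have hsol := ((isWeakSolution_cauchyTransform hC isOpen_disc isOpen_puncturedDisc hf hf₁
    hf₂).congr_ae isOpen_disc_prod hT.symm).comp_phi hclosed.1
  have hnorm := calc
    eLpNorm (opT disc puncturedDisc (transfer α) ∘ phi) p (volume.restrict hartogs)
    _ = eLpNorm (cauchyTransform (volume.restrict disc) (transfer α).c₁ ∘ phi) p
          (volume.restrict hartogs) := eLpNorm_congr_ae hTphi
    _ ≤ C * eLpNorm α.c₁ p (volume.restrict hartogs) :=
      eLpNorm_cauchyTransform_transfer_comp_phi_le hC hp hLp.1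
    _ ≤ (C + 1 : ℝ≥0) * eLpNorm α.c₁ p (volume.restrict hartogs) := by
      gcongr
      exact le_self_add
  exact ⟨opTWellDefined_of_c₂_ae_eq_zero hC isOpen_puncturedDisc hf₁ hf₂ hisScrD hscrD, hsol,
    ⟨hsol.1.aestronglyMeasurable, hnorm.trans_lt (ENNReal.mul_lt_top ENNReal.coe_lt_top hLp.2)⟩,
    hnorm⟩

theorem theorem5p2 (p : ℝ≥0∞) (hp : 1 ≤ p) (hp' : p ≠ ∞) :
    ∃ C : ℝ≥0, 0 < C ∧ ∀ α : HartogsDbar.Form01,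
      α.WeaklyClosed HartogsDbar.hartogs →
      (∀ᵐ z ∂(volume.restrict HartogsDbar.hartogs),
        conj z.1 * α.c₁ z + conj z.2 * α.c₂ z = 0) →
      MemLp α.c₁ p (volume.restrict HartogsDbar.hartogs) →
      HartogsDbar.OpTWellDefined HartogsDbar.disc HartogsDbar.puncturedDisc
          (HartogsDbar.transfer α) ∧
      HartogsDbar.IsWeakSolution HartogsDbar.hartogs
        (HartogsDbar.opT HartogsDbar.disc HartogsDbar.puncturedDisc
          (HartogsDbar.transfer α) ∘ HartogsDbar.phi) α ∧
      MemLp (HartogsDbar.opT HartogsDbar.disc HartogsDbar.puncturedDisc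
          (HartogsDbar.transfer α) ∘ HartogsDbar.phi) p
        (volume.restrict HartogsDbar.hartogs) ∧
      eLpNorm (HartogsDbar.opT HartogsDbar.disc HartogsDbar.puncturedDisc
          (HartogsDbar.transfer α) ∘ HartogsDbar.phi) p
          (volume.restrict HartogsDbar.hartogs) ≤
        C * eLpNorm α.c₁ p (volume.restrict HartogsDbar.hartogs) := by
  obtain ⟨C, hC, hbound⟩ := theorem5p2_general
  exact ⟨C, hC, hbound p hp⟩
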